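/- Let $G$ be a connected, simply connected, solvable (real, finite-dimensional) Lie group, let $\mathrm{Aut}(G)$ be its group of Lie group automorphisms with the compact-open topology, let $K$ be a maximal compact subgroup of $\mathrm{Aut}(G)$, and let $\Gamma$ be a discrete cocompact subgroup of $G\rtimes K$. Let $G\rtimes K$ act on $G$ by $(g,k)\cdot x=g\,k(x)$, and assume that $\Gamma$ acts freely on $G$ and that $[\Gamma:G\cap\Gamma]<\infty$. (Thus $\Gamma\backslash G$ is an infra-solvmanifold modeled on $G$.) Let $hol(\Gamma)\subset\mathrm{Aut}(G)$ be the image of $\Gamma$ under the projection $G\rtimes K\to K$, and put $\widetilde G=G\rtimes hol(\Gamma)$ with the product topology. Then: (1) $hol(\Gamma)$ is finite, and $\widetilde G$ is a Lie group (containing $G$ as an open Lie subgroup) that is virtually connected, i.e. has finitely many connected components, and virtually solvable, i.e. has a solvable subgroup of finite index. (2) $hol(\Gamma)$ is a maximal compact subgroup of $\widetilde G$. (3) $\Gamma$ is contained in $\widetilde G$, and it is a torsion-free, cocompact, discrete subgroup of $\widetilde G$. (4) $\Gamma\backslash G$ and $\Gamma\backslash\widetilde G/hol(\Gamma)$, with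 their quotient topologies, are (Hausdorff, second countable) smooth manifolds for which the projections from $G$ and from $\widetilde G$ are local diffeomorphisms, and the map $\Gamma x\mapsto \Gamma\,(x,1)\,hol(\Gamma)$ is a diffeomorphism $\Gamma\backslash G\cong\Gamma\backslash\widetilde G/hol(\Gamma)$. -/

import Mathlib

open scoped Manifold ContDiff

/-! ### Semidirect products: topology, and the affine action on the first factor -/

namespace SemidirectProduct

/-- The product topology on a semidirect product. -/
instance instTopologicalSpaceProd {N H : Type*} [Group N] [Group H] {φ : H →* MulAut N}
    [TopologicalSpace N] [TopologicalSpace H] : TopologicalSpace (N ⋊[φ] H) :=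
  TopologicalSpace.induced (fun x => (x.left, x.right)) inferInstance

/-- The action of `N ⋊ H` on `N` by affine maps: `(n, h)` sends `x` to `n * h(x)`. -/
instance instMulActionAffine {N H : Type*} [Group N] [Group H] {φ : H →* MulAut N} :
    MulAction (N ⋊[φ] H) N where
  smul g x := g.left * φ g.right x
  one_smul x := by
    change (1 : N ⋊[φ] H).left * φ (1 : N ⋊[φ] H).right x = x
    simp
  mul_smul g h x := by
    change (g * h).left * φ (g * h).right x = g.left * φ g.right (h.left * φ h.right x)
    simp [mul_assoc]

end SemidirectProduct

/-! ### The automorphism group of a Lie group -/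

section LieAut

variable (E : Type*) [NormedAddCommGroup E] [NormedSpace ℝ E]
  (G : Type*) [TopologicalSpace G] [ChartedSpace E G] [Group G]

/-- `Aut(G)` for a Lie group `G`: the group automorphisms of `G` that are smooth with smooth
inverse. -/
def LieAut : Subgroup (MulAut G) where
  carrier := {φ | ContMDiff 𝓘(ℝ, E) 𝓘(ℝ, E) ∞ (φ : G → G) ∧
    ContMDiff 𝓘(ℝ, E) 𝓘(ℝ, E) ∞ (φ.symm : G → G)}
  one_mem' := ⟨contMDiff_id, contMDiff_id⟩
  mul_mem' hφ hψ := ⟨hφ.1.comp hψ.1, hψ.2.comp hφ.2⟩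
  inv_mem' hφ := ⟨hφ.2, hφ.1⟩

/-- The compact-open topology on `Aut(G)`. -/
instance LieAut.instTopologicalSpace : TopologicalSpace (LieAut E G) :=
  TopologicalSpace.induced
    (fun φ => (⟨fun x => (φ : MulAut G) x, φ.2.1.continuous⟩ : C(G, G))) inferInstance

variable {E G}

/-- `G ⋊ H` for a subgroup `H` of `Aut(G)`. -/
abbrev AffWith (H : Subgroup (LieAut E G)) : Type _ :=
  G ⋊[(LieAut E G).subtype.comp H.subtype] H

/-- The affine group `Aff(G) = G ⋊ Aut(G)`. -/
abbrev Aff (E : Type*) [NormedAddCommGroup E] [NormedSpace ℝ E]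
    (G : Type*) [TopologicalSpace G] [ChartedSpace E G] [Group G] : Type _ :=
  G ⋊[(LieAut E G).subtype] (LieAut E G)

/-- The inclusion `G ⋊ H → G ⋊ Aut(G)`. -/
def AffWith.toAff (H : Subgroup (LieAut E G)) : AffWith H →* Aff E G :=
  SemidirectProduct.map (MonoidHom.id G) H.subtype (fun _ => rfl)

/-- The normal factor `G`, as a subgroup of `G ⋊ H`. -/
def AffWith.translations (H : Subgroup (LieAut E G)) : Subgroup (AffWith H) :=
  (SemidirectProduct.inl : G →* AffWith H).range

/-- The factor `H`, as a subgroup of `G ⋊ H`. -/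
def AffWith.linearPart (H : Subgroup (LieAut E G)) : Subgroup (AffWith H) :=
  (SemidirectProduct.inr : H →* AffWith H).range

/-- The image `hol(Γ) ⊆ Aut(G)` of a subgroup `Γ` of `G ⋊ K` under the holonomy projection. -/
def holonomy {K : Subgroup (LieAut E G)} (Γ : Subgroup (AffWith K)) : Subgroup (LieAut E G) :=
  Γ.map (K.subtype.comp SemidirectProduct.rightHom)

/-- The group `Γ ⊆ G ⋊ K`, regarded as a subgroup of `G ⋊ hol(Γ)`: the elements of `G ⋊ hol(Γ)`
whose image in `G ⋊ Aut(G)` lies in the image of `Γ`. -/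
def inHolonomyExtension {K : Subgroup (LieAut E G)} (Γ : Subgroup (AffWith K)) :
    Subgroup (AffWith (holonomy Γ)) :=
  (Γ.map (AffWith.toAff K)).comap (AffWith.toAff (holonomy Γ))

end LieAut

/-! ### Properties of groups and subgroups -/

section Groups

variable (L : Type*) [Group L]

/-- A group is virtually solvable if it has a solvable subgroup of finite index. -/
def IsVirtuallySolvable : Prop :=
  ∃ H : Subgroup L, H.FiniteIndex ∧ Group.IsSolvable H

/-- A topological group is virtually connected if it has finitely many connected components. -/
def IsVirtuallyConnected [TopologicalSpace L] : Prop :=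
  Finite (ConnectedComponents L)

variable {L}

/-- A subgroup is torsion-free if its only element of finite order is `1`. -/
def Subgroup.IsTorsionFreeGroup (Γ : Subgroup L) : Prop :=
  ∀ γ ∈ Γ, IsOfFinOrder γ → γ = 1

/-- `K` is maximal among the compact subgroups of `L`. -/
def Subgroup.IsMaximalCompact [TopologicalSpace L] (K : Subgroup L) : Prop :=
  Maximal (fun C : Subgroup L => IsCompact (C : Set L)) K

/-- `Γ` is cocompact in `L`: the space `Γ \ L` of cosets `Γ x` is compact. -/
def Subgroup.IsCocompact [TopologicalSpace L] (Γ : Subgroup L) : Prop :=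
  CompactSpace (Quotient (QuotientGroup.rightRel Γ))

/-- `Γ` is a discrete subgroup of `L`. -/
def Subgroup.IsDiscrete [TopologicalSpace L] (Γ : Subgroup L) : Prop :=
  DiscreteTopology Γ

end Groups

/-! ### Orbit spaces and double coset spaces -/

/-- The orbit space `Γ \ X`, with the quotient topology. -/
abbrev OrbitSpace {A : Type*} [Group A] (Γ : Subgroup A) (X : Type*) [MulAction A X] : Type _ :=
  Quotient (MulAction.orbitRel Γ X)

/-- The double coset space `Γ \ L / K`, with the quotient topology. -/
abbrev DoubleCosetSpace {L : Type*} [Group L] (Γ K : Subgroup L) : Type _ :=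
  Quotient (DoubleCoset.setoid (Γ : Set L) (K : Set L))

/-- `Y` is a smooth manifold (Hausdorff and second countable) and `π : X → Y` is a surjective local
diffeomorphism. For given `π` and `X`, this determines the smooth structure of `Y`. -/
structure IsQuotientManifold (E : Type*) [NormedAddCommGroup E] [NormedSpace ℝ E]
    {X Y : Type*} [TopologicalSpace X] [ChartedSpace E X] [TopologicalSpace Y] [ChartedSpace E Y]
    (π : X → Y) : Prop where
  t2 : T2Space Y
  secondCountable : SecondCountableTopology Y
  isManifold : IsManifold 𝓘(ℝ, E) ∞ Y
  surjective : Function.Surjective π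
  isLocalDiffeomorph : IsLocalDiffeomorph 𝓘(ℝ, E) 𝓘(ℝ, E) ∞ π

/-! The holonomy group is finite because the projection to `K` kills `G ∩ Γ`, which has finite index
in `Γ`. Hence `G ⋊ hol(Γ)` is a finite disjoint union of copies of `G`, and its Lie structure,
virtual connectedness and virtual solvability follow. The same index hypothesis makes the action of
`Γ` on `G` properly discontinuous, so `Γ \ G` is a quotient manifold; forgetting the `hol(Γ)`
coordinate identifies it with the double coset space.

Two claims need structure theory. Maximality of `hol(Γ)` reduces to the absence of nontrivial
compact subgroups in a simply connected solvable group (`IsLieChart.eq_bot_of_isCompact`).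
Torsion-freeness reduces to the existence of a fixed point for every affine map `x ↦ g α(x)` of
finite order (`IsLieChart.exists_fixed_point`), which freeness excludes. Both go by induction on the
dimension through `IsLieChart.exists_vector_quotient`: a homomorphism `Φ` onto a nonzero vector
group `F`, natural under the relevant endomorphisms, with simply connected kernel. In `F` a compact
subgroup is zero, and an affine map with a periodic orbit fixes the barycentre of that orbit; the
rest takes place in the kernel.

To find `Φ`, let `V` be the span of the vectors `X - Ad(g) X`. They are tangent to curves of
commutators, so if `V` were everything, the commutator subgroup would contain a neighbourhood of
`1`, hence equal `G`, against solvability. The projection `q` along `V` is `Ad`-invariant, so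
composing it with the left logarithmic derivative gives a bi-invariant 1-form. Such a form is
closed; its primitive is a local homomorphism, which monodromy extends to `Φ`. A global continuous
section of `Φ` makes the kernel a retract of `G`, hence simply connected.

The induction only needs one `C^2` chart at the identity (`IsLieChart`), which kernels inherit, so
no Lie group structure on subgroups is required. -/

open scoped Manifold ContDiff Topology commutatorElement
open Set Filter

/-! ### Groups with a chart at the identity in which the operations are `C^2` -/

section LieChart

variable {E G : Type*} [NormedAddCommGroup E] [NormedSpace ℝ E] [TopologicalSpace G] [Group G]

/-- A chart of `G` at the identity, centred at `0`, in which the multiplication, the inversion and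
the conjugations are `C^2` near the identity. -/
structure IsLieChart (φ : OpenPartialHomeomorph G E) : Prop where
  one_mem : 1 ∈ φ.source
  map_one : φ 1 = 0
  contDiffAt_mul : ContDiffAt ℝ 2 (fun p : E × E => φ (φ.symm p.1 * φ.symm p.2)) 0
  contDiffAt_inv : ContDiffAt ℝ 2 (fun x => φ (φ.symm x)⁻¹) 0
  contDiffAt_conj : ∀ g, ContDiffAt ℝ 2 (fun x => φ (g * φ.symm x * g⁻¹)) 0

/-- The adjoint action of `G`, in a chart at the identity. -/
noncomputable def chartAd (φ : OpenPartialHomeomorph G E) (g : G) : E →L[ℝ] E :=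
  fderiv ℝ (fun x => φ (g * φ.symm x * g⁻¹)) 0

end LieChart

/-! ### Closedness and primitives of bi-invariant 1-forms -/

section ClosedForm

variable {E F : Type*} [NormedAddCommGroup E] [NormedSpace ℝ E]
  [NormedAddCommGroup F] [NormedSpace ℝ F]

/-- A `1`-form whose pullback under a local multiplication `m` is the sum of its pullbacks under
the projections is closed. -/
theorem eventually_fderiv_symmetric_of_pullback_eq {m : E × E → E} (hm : ContDiffAt ℝ 2 m 0)
    (hm0 : ∀ᶠ x in 𝓝 (0 : E), m (x, 0) = x) {η : E → E →L[ℝ] F} (hη : ContDiffAt ℝ 1 η 0)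
    (hinv : ∀ᶠ p in 𝓝 (0 : E × E), η (m p) ∘L fderiv ℝ m p =
      η p.1 ∘L ContinuousLinearMap.fst ℝ E E + η p.2 ∘L ContinuousLinearMap.snd ℝ E E)
    (hsurj : ∀ᶠ x in 𝓝 (0 : E), Function.Surjective
      (fderiv ℝ m (x, 0) ∘L ContinuousLinearMap.inr ℝ E E)) :
    ∀ᶠ x in 𝓝 (0 : E), ∀ u v, fderiv ℝ η x u v = fderiv ℝ η x v u := by
  have hm' := hm.eventually (by simp)
  have hη' := hη.eventually (by simp)
  have hc : Tendsto (fun x : E => (x, (0 : E))) (𝓝 0) (𝓝 (0 : E × E)) := by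
    have : Continuous fun x : E => (x, (0 : E)) := by fun_prop
    exact this.tendsto 0
  filter_upwards [hm0, hm0.eventually_nhds, hsurj, hc.eventually hinv.eventually_nhds,
    hc.eventually hm', hη', hη'.self_of_nhds.eventually (by simp)] with
    x hx hxn hsx hix hmx hηx _ u v
  -- The vector `v` is realised as the differential of right multiplication at `(x, 0)`, so that the
  -- pair `u, v` comes from the two factors of `E × E`.
  obtain ⟨w, hw⟩ := hsx v
  have dm : HasFDerivAt m (fderiv ℝ m (x, 0)) (x, 0) :=
    (hmx.differentiableAt (by simp)).hasFDerivAt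
  have dη : HasFDerivAt η (fderiv ℝ η x) (m (x, 0)) := by
    rw [hx]; exact (hηx.differentiableAt (by simp)).hasFDerivAt
  have dηx : HasFDerivAt η (fderiv ℝ η x) x := by rw [hx] at dη; exact dη
  have d2m : HasFDerivAt (fderiv ℝ m) (fderiv ℝ (fderiv ℝ m) (x, 0)) (x, 0) :=
    ((hmx.fderiv_right (m := 1) (by norm_num [one_add_one_eq_two])).differentiableAt
      (by simp)).hasFDerivAt
  have sym := (hmx.isSymmSndFDerivAt (by simp [minSmoothness_of_isRCLikeNormedField]))
  have lhs := (dη.comp (x, (0 : E)) dm).clm_comp d2m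
  have hd : DifferentiableAt ℝ η 0 := hη.differentiableAt (by simp)
  have d2 : HasFDerivAt (fun p : E × E => η p.2)
      (fderiv ℝ η 0 ∘L ContinuousLinearMap.snd ℝ E E) (x, 0) :=
    hd.hasFDerivAt.comp (x, (0 : E)) hasFDerivAt_snd
  have d1 : HasFDerivAt (fun p : E × E => η p.1)
      (fderiv ℝ η x ∘L ContinuousLinearMap.fst ℝ E E) (x, 0) :=
    dηx.comp (x, (0 : E)) hasFDerivAt_fst
  have rhs := (d1.clm_comp (hasFDerivAt_const (ContinuousLinearMap.fst ℝ E E) (x, (0 : E)))).add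
    (d2.clm_comp (hasFDerivAt_const (ContinuousLinearMap.snd ℝ E E) (x, (0 : E))))
  have key := (lhs.congr_of_eventuallyEq (EventuallyEq.symm hix)).unique rhs
  -- On mixed pairs the differentiated right-hand side vanishes, since each of its summands involves
  -- one variable only. On the left, besides the derivative of `η`, there remains `η` of a second
  -- derivative of `m`, the same in both orders by symmetry; it cancels.
  have h1 := congrArg (fun T => T (u, 0) (0, w)) key
  have h2 := congrArg (fun T => T (0, w) (u, 0)) key
  have hu : fderiv ℝ m (x, 0) (u, 0) = u := by
    have : HasFDerivAt (fun z : E => m (z, 0))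
        (fderiv ℝ m (x, 0) ∘L ContinuousLinearMap.inl ℝ E E) x :=
      dm.comp x (hasFDerivAt_prodMk_left x (0 : E))
    have := this.unique ((hasFDerivAt_id x).congr_of_eventuallyEq hxn)
    simpa using congrArg (fun T => T u) this
  have hw' : fderiv ℝ m (x, 0) (0, w) = v := by simpa using hw
  simp [hu, hw', hx] at h1 h2
  rw [sym.eq (0, w) (u, 0)] at h2
  exact add_left_cancel (h1.trans h2.symm)

/-- A `1`-form as in `eventually_fderiv_symmetric_of_pullback_eq` has a primitive near `0`, which
is additive with respect to the local multiplication. -/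
theorem exists_additive_primitive [CompleteSpace F] {m : E × E → E} (hm : ContDiffAt ℝ 2 m 0)
    (hm0 : ∀ᶠ x in 𝓝 (0 : E), m (x, 0) = x) {η : E → E →L[ℝ] F} (hη : ContDiffAt ℝ 1 η 0)
    (hinv : ∀ᶠ p in 𝓝 (0 : E × E), η (m p) ∘L fderiv ℝ m p =
      η p.1 ∘L ContinuousLinearMap.fst ℝ E E + η p.2 ∘L ContinuousLinearMap.snd ℝ E E)
    (hsurj : ∀ᶠ x in 𝓝 (0 : E), Function.Surjective
      (fderiv ℝ m (x, 0) ∘L ContinuousLinearMap.inr ℝ E E)) :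
    ∃ f : E → F, f 0 = 0 ∧ ContDiffAt ℝ 2 f 0 ∧ HasFDerivAt f (η 0) 0 ∧
      ∀ᶠ p in 𝓝 (0 : E × E), f (m p) = f p.1 + f p.2 := by
  have hm00 : m 0 = 0 := hm0.self_of_nhds
  obtain ⟨r, hr, hball⟩ := Metric.eventually_nhds_iff_ball.1
    ((eventually_fderiv_symmetric_of_pullback_eq hm hm0 hη hinv hsurj).and
      (hη.eventually (by simp)))
  obtain ⟨f₀, hf₀⟩ := (convex_ball (0 : E) r).exists_forall_hasFDerivAt_of_fderiv_symmetric
    Metric.isOpen_ball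
    (fun x hx => ((hball x hx).2.differentiableAt (by simp)).differentiableWithinAt)
    (fun x hx => (hball x hx).1)
  set f : E → F := fun x => f₀ x - f₀ 0 with hf
  have hfd : ∀ x ∈ Metric.ball (0 : E) r, HasFDerivAt f (η x) x :=
    fun x hx => (hf₀ x hx).sub_const _
  have hf0 : f 0 = 0 := by simp [hf]
  refine ⟨f, hf0, ?_, hfd 0 (Metric.mem_ball_self hr), ?_⟩
  · have := (contDiffAt_succ_iff_hasFDerivAt (n := 1)).2
      ⟨η, ⟨_, Metric.ball_mem_nhds 0 hr, hfd⟩, by exact_mod_cast hη⟩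
    simpa [one_add_one_eq_two] using this
  · have hmc : Tendsto m (𝓝 0) (𝓝 0) := by simpa [hm00] using hm.continuousAt.tendsto
    have h1 : ∀ᶠ p in 𝓝 (0 : E × E), p.1 ∈ Metric.ball (0 : E) r :=
      (continuous_fst.tendsto (0 : E × E)).eventually (Metric.ball_mem_nhds _ hr)
    have h2 : ∀ᶠ p in 𝓝 (0 : E × E), p.2 ∈ Metric.ball (0 : E) r :=
      (continuous_snd.tendsto (0 : E × E)).eventually (Metric.ball_mem_nhds _ hr)
    obtain ⟨s, hs, hsb⟩ := Metric.eventually_nhds_iff_ball.1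
      (((hinv.and (hm.eventually (by simp))).and
        (hmc.eventually (Metric.ball_mem_nhds (0 : E) hr))).and (h1.and h2))
    -- The derivative of the additivity defect is exactly the difference of the two sides of `hinv`.
    -- The defect is therefore constant on a ball, and it vanishes at the origin.
    have hder : ∀ p ∈ Metric.ball (0 : E × E) s,
        HasFDerivAt (fun p => f (m p) - (f p.1 + f p.2)) (0 : E × E →L[ℝ] F) p := by
      intro p hp
      obtain ⟨⟨⟨hi, hmp⟩, hmr⟩, hp1, hp2⟩ := hsb p hp
      have a := (hfd _ hmr).comp p (hmp.differentiableAt (by simp)).hasFDerivAt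
      have b := ((hfd _ hp1).comp p hasFDerivAt_fst).add ((hfd _ hp2).comp p hasFDerivAt_snd)
      have := a.sub b
      rwa [hi, sub_self] at this
    filter_upwards [Metric.ball_mem_nhds (0 : E × E) hs] with p hp
    have := (convex_ball (0 : E × E) s).is_const_of_fderivWithin_eq_zero (𝕜 := ℝ)
      (f := fun p => f (m p) - (f p.1 + f p.2))
      (fun x hx => (hder x hx).differentiableAt.differentiableWithinAt)
      (fun x hx => by
        rw [fderivWithin_of_isOpen Metric.isOpen_ball hx]; exact (hder x hx).fderiv)
      hp (Metric.mem_ball_self hs)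
    simp only [hm00, hf0, Prod.fst_zero, Prod.snd_zero, add_zero, sub_zero] at this
    exact sub_eq_zero.1 this

end ClosedForm

/-! ### The left logarithmic derivative and its invariance -/

namespace IsLieChart

variable {E G : Type*} [NormedAddCommGroup E] [NormedSpace ℝ E] [TopologicalSpace G] [Group G]
  {φ : OpenPartialHomeomorph G E}

theorem zero_mem (hφ : IsLieChart φ) : 0 ∈ φ.target := by
  rw [← hφ.map_one]; exact φ.map_source hφ.one_mem

theorem symm_zero (hφ : IsLieChart φ) : φ.symm 0 = 1 := by
  rw [← hφ.map_one]; exact φ.left_inv hφ.one_mem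

theorem tendsto_symm (hφ : IsLieChart φ) : Tendsto φ.symm (𝓝 0) (𝓝 1) := by
  have := (φ.continuousAt_symm hφ.zero_mem).tendsto
  rwa [hφ.symm_zero] at this

theorem tendsto_symm_inv [IsTopologicalGroup G] (hφ : IsLieChart φ) :
    Tendsto (fun x => (φ.symm x)⁻¹) (𝓝 0) (𝓝 1) := by
  simpa using hφ.tendsto_symm.inv

theorem tendsto_one (hφ : IsLieChart φ) : Tendsto φ (𝓝 1) (𝓝 0) := by
  have := (φ.continuousAt hφ.one_mem).tendsto
  rwa [hφ.map_one] at this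

theorem eventually_mem_source (hφ : IsLieChart φ) {X : Type*} {l : Filter X} {u : X → G}
    (hu : Tendsto u l (𝓝 1)) : ∀ᶠ x in l, φ.symm (φ (u x)) = u x := by
  filter_upwards [hu.eventually (φ.open_source.mem_nhds hφ.one_mem)] with x hx
  exact φ.left_inv hx

theorem eventually_mem_target (hφ : IsLieChart φ) {X : Type*} {l : Filter X} {u : X → E}
    (hu : Tendsto u l (𝓝 0)) : ∀ᶠ x in l, φ (φ.symm (u x)) = u x := by
  filter_upwards [hu.eventually (φ.open_target.mem_nhds hφ.zero_mem)] with x hx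
  exact φ.right_inv hx

theorem eventually_mul_zero (hφ : IsLieChart φ) :
    ∀ᶠ x in 𝓝 (0 : E), φ (φ.symm x * φ.symm 0) = x := by
  filter_upwards [hφ.eventually_mem_target tendsto_id] with x hx
  simpa [hφ.symm_zero] using hx

theorem mul_zero_zero (hφ : IsLieChart φ) : φ (φ.symm 0 * φ.symm 0) = 0 := by
  simp [hφ.symm_zero, hφ.map_one]

theorem tendsto_symm_comp (hφ : IsLieChart φ) {X : Type*} [TopologicalSpace X] {x₀ : X} {u : X → E}
    (hu : Continuous u) (hx : u x₀ = 0) : Tendsto (fun x => φ.symm (u x)) (𝓝 x₀) (𝓝 1) :=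
  hφ.tendsto_symm.comp (by simpa [hx] using hu.tendsto x₀)

/-- Three points near `0`: the identity expressing that the left logarithmic derivative is
invariant under left translations. -/
theorem eventually_left_identity [IsTopologicalGroup G] (hφ : IsLieChart φ) :
    ∀ᶠ p : E × E × E in 𝓝 0,
      φ (φ.symm (φ (φ.symm (φ (φ.symm p.1 * φ.symm p.2.1)))⁻¹) *
        φ.symm (φ (φ.symm p.1 * φ.symm p.2.2))) =
      φ (φ.symm (φ (φ.symm p.2.1)⁻¹) * φ.symm p.2.2) := by
  have h1 := hφ.tendsto_symm_comp (x₀ := (0 : E × E × E)) (u := fun p => p.1) (by fun_prop) rfl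
  have h2 := hφ.tendsto_symm_comp (x₀ := (0 : E × E × E)) (u := fun p => p.2.1) (by fun_prop) rfl
  have h3 := hφ.tendsto_symm_comp (x₀ := (0 : E × E × E)) (u := fun p => p.2.2) (by fun_prop) rfl
  have h12 := h1.mul h2
  have h13 := h1.mul h3
  have h12' := h12.inv
  have h2' := h2.inv
  simp only [mul_one, inv_one] at h12 h13 h12' h2'
  filter_upwards [hφ.eventually_mem_source h12, hφ.eventually_mem_source h13,
    hφ.eventually_mem_source h12', hφ.eventually_mem_source h2'] with p e1 e2 e3 e4
  rw [e1, e2, e3, e4]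
  group

/-- Three points near `0`: the identity expressing that right translations act on the left
logarithmic derivative by the adjoint action. -/
theorem eventually_right_identity [IsTopologicalGroup G] (hφ : IsLieChart φ) :
    ∀ᶠ p : E × E × E in 𝓝 0,
      φ (φ.symm (φ (φ.symm (φ (φ.symm p.1 * φ.symm p.2.1)))⁻¹) *
        φ.symm (φ (φ.symm p.2.2 * φ.symm p.2.1))) =
      φ ((φ.symm p.2.1)⁻¹ * φ.symm (φ (φ.symm (φ (φ.symm p.1)⁻¹) * φ.symm p.2.2)) *
        (φ.symm p.2.1)⁻¹⁻¹) := by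
  have h1 := hφ.tendsto_symm_comp (x₀ := (0 : E × E × E)) (u := fun p => p.1) (by fun_prop) rfl
  have h2 := hφ.tendsto_symm_comp (x₀ := (0 : E × E × E)) (u := fun p => p.2.1) (by fun_prop) rfl
  have h3 := hφ.tendsto_symm_comp (x₀ := (0 : E × E × E)) (u := fun p => p.2.2) (by fun_prop) rfl
  have h12 := h1.mul h2
  have h32 := h3.mul h2
  have h12' := h12.inv
  have h1' := h1.inv
  have h13 := h1'.mul h3
  simp only [mul_one, inv_one] at h12 h13 h12' h1' h32
  filter_upwards [hφ.eventually_mem_source h12, hφ.eventually_mem_source h13,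
    hφ.eventually_mem_source h12', hφ.eventually_mem_source h1', hφ.eventually_mem_source h32]
    with p e1 e2 e3 e4 e5
  rw [e1, e3, e4, e2, e5]
  group

/-- The left logarithmic derivative: the differential at `x` of `z ↦ x⁻¹ z`. -/
noncomputable def _root_.chartLeftLog (φ : OpenPartialHomeomorph G E) (x : E) : E →L[ℝ] E :=
  fderiv ℝ (fun z => φ (φ.symm (φ (φ.symm x)⁻¹) * φ.symm z)) x

theorem inv_zero (hφ : IsLieChart φ) : φ (φ.symm 0)⁻¹ = 0 := by
  simp [hφ.symm_zero, hφ.map_one]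

theorem tendsto_inv_prod (hφ : IsLieChart φ) :
    Tendsto (fun x : E => (φ (φ.symm x)⁻¹, x)) (𝓝 0) (𝓝 (0 : E × E)) := by
  have := (hφ.contDiffAt_inv.continuousAt.prodMk continuousAt_id).tendsto
  rw [hφ.inv_zero] at this
  exact this

/-- The map being differentiated is the local multiplication with its first argument frozen at the
inverse of `x`, so its regularity comes from that of the multiplication near `0`. -/
theorem eventually_hasFDerivAt_leftLog (hφ : IsLieChart φ) :
    ∀ᶠ x in 𝓝 (0 : E), HasFDerivAt (fun z => φ (φ.symm (φ (φ.symm x)⁻¹) * φ.symm z))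
      (chartLeftLog φ x) x ∧ chartLeftLog φ x =
        fderiv ℝ (fun p : E × E => φ (φ.symm p.1 * φ.symm p.2)) (φ (φ.symm x)⁻¹, x) ∘L
          ContinuousLinearMap.inr ℝ E E := by
  filter_upwards [hφ.tendsto_inv_prod.eventually (hφ.contDiffAt_mul.eventually (by simp))]
    with x hx
  have h := (hx.differentiableAt (by simp)).hasFDerivAt.comp x
    (hasFDerivAt_prodMk_right (φ (φ.symm x)⁻¹) x)
  have h' : HasFDerivAt (fun z => φ (φ.symm (φ (φ.symm x)⁻¹) * φ.symm z)) _ x := h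
  refine ⟨?_, ?_⟩
  · rw [chartLeftLog, h'.fderiv]; exact h'
  · rw [chartLeftLog, h'.fderiv]

/-- One derivative is lost from the `C^2` operations, leaving just the regularity needed to speak of
a closed form. -/
theorem contDiffAt_leftLog (hφ : IsLieChart φ) : ContDiffAt ℝ 1 (chartLeftLog φ) 0 := by
  have h1 : ContDiffAt ℝ 1 (fderiv ℝ (fun p : E × E => φ (φ.symm p.1 * φ.symm p.2)))
      (φ (φ.symm 0)⁻¹, 0) := by
    rw [hφ.inv_zero]
    exact hφ.contDiffAt_mul.fderiv_right (m := 1) (by norm_num [one_add_one_eq_two])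
  have h2 : ContDiffAt ℝ 1 (fun x : E => (φ (φ.symm x)⁻¹, x)) 0 :=
    (hφ.contDiffAt_inv.of_le (by norm_num)).prodMk contDiffAt_id
  have h3 := (ContDiffAt.comp (f := fun x : E => (φ (φ.symm x)⁻¹, x)) (0 : E) h1 h2).clm_comp
    (contDiffAt_const (c := ContinuousLinearMap.inr ℝ E E) (x := (0 : E)))
  exact h3.congr_of_eventuallyEq (hφ.eventually_hasFDerivAt_leftLog.mono fun x hx => hx.2)

theorem leftLog_zero (hφ : IsLieChart φ) : chartLeftLog φ 0 = ContinuousLinearMap.id ℝ E := by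
  have : (fun z => φ (φ.symm (φ (φ.symm 0)⁻¹) * φ.symm z)) =ᶠ[𝓝 0] id := by
    filter_upwards [hφ.eventually_mem_target tendsto_id] with x hx
    simpa [hφ.map_one, hφ.symm_zero] using hx
  rw [chartLeftLog, this.fderiv_eq, fderiv_id]

theorem hasFDerivAt_ad (hφ : IsLieChart φ) (g : G) :
    HasFDerivAt (fun x => φ (g * φ.symm x * g⁻¹)) (chartAd φ g) 0 :=
  ((hφ.contDiffAt_conj g).differentiableAt (by simp)).hasFDerivAt

/-- Differentiate `x (x⁻¹ z) = z` in `z` at `z = x`. The resulting right inverse supplies the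
surjectivity hypothesis of `exists_additive_primitive`. -/
theorem eventually_surjective_mul [IsTopologicalGroup G] (hφ : IsLieChart φ) :
    ∀ᶠ x in 𝓝 (0 : E), (fderiv ℝ (fun p : E × E => φ (φ.symm p.1 * φ.symm p.2)) (x, 0) ∘L
      ContinuousLinearMap.inr ℝ E E) ∘L chartLeftLog φ x = ContinuousLinearMap.id ℝ E := by
  have hc : Tendsto (fun x : E => (x, (0 : E))) (𝓝 0) (𝓝 (0 : E × E)) := by
    have : Continuous fun x : E => (x, (0 : E)) := by fun_prop
    exact this.tendsto 0
  have hid : ∀ᶠ p in 𝓝 (0 : E × E),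
      φ (φ.symm p.1 * φ.symm (φ (φ.symm (φ (φ.symm p.1)⁻¹) * φ.symm p.2))) = p.2 := by
    have h1 := hφ.tendsto_symm_comp (x₀ := (0 : E × E)) (u := fun p => p.1) (by fun_prop) rfl
    have h2 := hφ.tendsto_symm_comp (x₀ := (0 : E × E)) (u := fun p => p.2) (by fun_prop) rfl
    have h1' := h1.inv
    have h12 := h1'.mul h2
    simp only [mul_one, inv_one] at h1' h12
    filter_upwards [hφ.eventually_mem_source h1', hφ.eventually_mem_source h12,
      hφ.eventually_mem_target (continuous_snd.tendsto (0 : E × E))] with p e1 e2 e3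
    rw [e1, e2, mul_inv_cancel_left, e3]
  have hd : Tendsto (fun x : E => (x, x)) (𝓝 0) (𝓝 (0 : E × E)) := by
    have : Continuous fun x : E => (x, x) := by fun_prop
    exact this.tendsto 0
  filter_upwards [hd.eventually hid.eventually_nhds,
    hc.eventually (hφ.contDiffAt_mul.eventually (by simp)),
    hφ.eventually_hasFDerivAt_leftLog, hφ.eventually_mem_source hφ.tendsto_symm_inv] with
    x hx hm hl hi
  have hz : ∀ᶠ z in 𝓝 x,
      φ (φ.symm x * φ.symm (φ (φ.symm (φ (φ.symm x)⁻¹) * φ.symm z))) = z :=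
    ((continuous_const.prodMk continuous_id).tendsto x).eventually hx
  have h0 : φ (φ.symm (φ (φ.symm x)⁻¹) * φ.symm x) = 0 := by
    rw [hi, inv_mul_cancel, hφ.map_one]
  have h1 : HasFDerivAt (fun z => φ (φ.symm x * φ.symm z))
      (fderiv ℝ (fun p : E × E => φ (φ.symm p.1 * φ.symm p.2)) (x, 0) ∘L
      ContinuousLinearMap.inr ℝ E E) (φ (φ.symm (φ (φ.symm x)⁻¹) * φ.symm x)) := by
    rw [h0]
    exact (hm.differentiableAt (by simp)).hasFDerivAt.comp (0 : E)
      (hasFDerivAt_prodMk_right x (0 : E))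
  refine (h1.comp x hl.1).unique (HasFDerivAt.congr_of_eventuallyEq (hasFDerivAt_id x) ?_)
  exact hz

/-- Differentiate `(x y)⁻¹ (x z) = y⁻¹ z` in `z` at `z = y`. -/
theorem eventually_left_invariant [IsTopologicalGroup G] (hφ : IsLieChart φ) :
    ∀ᶠ p in 𝓝 (0 : E × E), chartLeftLog φ (φ (φ.symm p.1 * φ.symm p.2)) ∘L
      (fderiv ℝ (fun p : E × E => φ (φ.symm p.1 * φ.symm p.2)) p ∘L
        ContinuousLinearMap.inr ℝ E E) = chartLeftLog φ p.2 := by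
  have hd : Tendsto (fun p : E × E => (p.1, p.2, p.2)) (𝓝 0) (𝓝 (0 : E × E × E)) := by
    have : Continuous (fun p : E × E => (p.1, p.2, p.2)) := by fun_prop
    exact this.tendsto 0
  have hm : Tendsto (fun p : E × E => φ (φ.symm p.1 * φ.symm p.2)) (𝓝 0) (𝓝 0) := by
    have := hφ.contDiffAt_mul.continuousAt.tendsto
    simpa [hφ.mul_zero_zero] using this
  filter_upwards [hd.eventually hφ.eventually_left_identity.eventually_nhds,
    hm.eventually hφ.eventually_hasFDerivAt_leftLog,
    (continuous_snd.tendsto (0 : E × E)).eventually hφ.eventually_hasFDerivAt_leftLog,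
    hφ.contDiffAt_mul.eventually (by simp)] with p hp hl1 hl2 hmp
  have hz : ∀ᶠ z in 𝓝 p.2, _ :=
    ((show Continuous (fun z : E => (p.1, p.2, z)) by fun_prop).tendsto p.2).eventually hp
  have h1 := (hmp.differentiableAt (by simp)).hasFDerivAt.comp p.2
    (hasFDerivAt_prodMk_right (𝕜 := ℝ) p.1 p.2)
  refine (hl1.1.comp p.2 h1).unique (hl2.1.congr_of_eventuallyEq ?_)
  exact hz

/-- Differentiate `(x y)⁻¹ (z y) = y⁻¹ (x⁻¹ z) y` in `z` at `z = x`. -/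
theorem eventually_right_invariant [IsTopologicalGroup G] (hφ : IsLieChart φ) :
    ∀ᶠ p in 𝓝 (0 : E × E), chartLeftLog φ (φ (φ.symm p.1 * φ.symm p.2)) ∘L
      (fderiv ℝ (fun p : E × E => φ (φ.symm p.1 * φ.symm p.2)) p ∘L
        ContinuousLinearMap.inl ℝ E E) = chartAd φ (φ.symm p.2)⁻¹ ∘L chartLeftLog φ p.1 := by
  have hd : Tendsto (fun p : E × E => (p.1, p.2, p.1)) (𝓝 0) (𝓝 (0 : E × E × E)) := by
    have : Continuous (fun p : E × E => (p.1, p.2, p.1)) := by fun_prop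
    exact this.tendsto 0
  have hm : Tendsto (fun p : E × E => φ (φ.symm p.1 * φ.symm p.2)) (𝓝 0) (𝓝 0) := by
    have := hφ.contDiffAt_mul.continuousAt.tendsto
    simpa [hφ.mul_zero_zero] using this
  have h1 : Tendsto (fun p : E × E => p.1) (𝓝 0) (𝓝 0) := continuous_fst.tendsto (0 : E × E)
  filter_upwards [hd.eventually hφ.eventually_right_identity.eventually_nhds,
    hm.eventually hφ.eventually_hasFDerivAt_leftLog,
    h1.eventually hφ.eventually_hasFDerivAt_leftLog,
    h1.eventually (hφ.eventually_mem_source hφ.tendsto_symm_inv),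
    hφ.contDiffAt_mul.eventually (by simp)] with p hp hl1 hl2 hi hmp
  have hz : ∀ᶠ z in 𝓝 p.1, _ :=
    ((show Continuous (fun z : E => (p.1, p.2, z)) by fun_prop).tendsto p.1).eventually hp
  have h1 := (hmp.differentiableAt (by simp)).hasFDerivAt.comp p.1
    (hasFDerivAt_prodMk_left (𝕜 := ℝ) p.1 p.2)
  have h0 : φ (φ.symm (φ (φ.symm p.1)⁻¹) * φ.symm p.1) = 0 := by
    rw [hi, inv_mul_cancel, hφ.map_one]
  have h2 := hφ.hasFDerivAt_ad (φ.symm p.2)⁻¹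
  rw [← h0] at h2
  refine (hl1.1.comp p.1 h1).unique ((h2.comp p.1 hl2.1).congr_of_eventuallyEq ?_)
  exact hz

/-- A linear map invariant under the adjoint action is the differential of a local
homomorphism. -/
theorem exists_local_additive [IsTopologicalGroup G] (hφ : IsLieChart φ)
    {F : Type*} [NormedAddCommGroup F] [NormedSpace ℝ F] [CompleteSpace F]
    {q : E →L[ℝ] F} (hq : ∀ g, q ∘L chartAd φ g = q) :
    ∃ f : E → F, f 0 = 0 ∧ ContDiffAt ℝ 2 f 0 ∧ HasFDerivAt f q 0 ∧
      ∀ᶠ p in 𝓝 (0 : E × E), f (φ (φ.symm p.1 * φ.symm p.2)) = f p.1 + f p.2 := by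
  have h := exists_additive_primitive (η := fun x => q ∘L chartLeftLog φ x) hφ.contDiffAt_mul
    hφ.eventually_mul_zero (contDiffAt_const.clm_comp hφ.contDiffAt_leftLog) ?_ ?_
  · simpa [hφ.leftLog_zero] using h
  -- On the first factor, right invariance leaves a factor `Ad(y⁻¹)` that `q` absorbs; on the
  -- second, left invariance applies directly.
  · filter_upwards [hφ.eventually_left_invariant, hφ.eventually_right_invariant] with p hl hr
    ext1
    · ext v
      have := congrArg (fun T => q (T v)) hr
      have hq' := congrArg (fun T => T (chartLeftLog φ p.1 v)) (hq (φ.symm p.2)⁻¹)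
      simp only [ContinuousLinearMap.comp_apply] at this hq'
      simpa [hq'] using this
    · ext v
      have := congrArg (fun T => q (T v)) hl
      simpa using this
  · filter_upwards [hφ.eventually_surjective_mul] with x hx v
    exact ⟨chartLeftLog φ x v, congrArg (fun T => T v) hx⟩

end IsLieChart

/-! ### Monodromy: extending local homomorphisms -/

section Monodromy

variable {G F : Type*} [TopologicalSpace G] [Group G] [AddCommGroup F]

/-- Split `g⁻¹ x = (g⁻¹ x₀)(x₀⁻¹ x)`. As the second summand does not depend on `g`, differences of
two translates of `f` are locally constant. -/
theorem eventually_apply_inv_mul [ContinuousMul G] {f : G → F} {U : Set G} (hU : U ∈ 𝓝 1)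
    (hf : ∀ x ∈ U, ∀ y ∈ U, f (x * y) = f x + f y) {g x₀ : G} (hx : g⁻¹ * x₀ ∈ U) :
    ∀ᶠ x in 𝓝 x₀, f (g⁻¹ * x) = f (g⁻¹ * x₀) + f (x₀⁻¹ * x) := by
  have h : Tendsto (fun x => x₀⁻¹ * x) (𝓝 x₀) (𝓝 1) := by
    simpa using (continuous_const_mul x₀⁻¹).tendsto x₀
  filter_upwards [h.eventually hU] with x hxU
  rw [← hf _ hx _ hxU]
  group

/-- The principal bundle with discrete structure group whose local sections are the local
translates of a local homomorphism. -/
def localHomBundle [IsTopologicalGroup G] [TopologicalSpace F] [DiscreteTopology F] {f : G → F}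
    {U : Set G} (hUo : IsOpen U) (h1 : 1 ∈ U) (hf : ∀ x ∈ U, ∀ y ∈ U, f (x * y) = f x + f y) :
    FiberBundleCore G G F where
  baseSet g := (fun x => g⁻¹ * x) ⁻¹' U
  isOpen_baseSet g := hUo.preimage (continuous_const_mul g⁻¹)
  indexAt x := x
  mem_baseSet_at x := by simpa using h1
  -- A coordinate `v` in the trivialisation indexed by `g` encodes the value `v + f (g⁻¹ x)`, which
  -- is independent of the index.
  coordChange g h x v := v + (f (g⁻¹ * x) - f (h⁻¹ * x))
  coordChange_self i x _ v := by simp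
  continuousOn_coordChange g h := by
    rintro ⟨x₀, v₀⟩ ⟨⟨hg, hh⟩, -⟩
    refine ContinuousAt.continuousWithinAt ?_
    have hc : ContinuousAt (fun p : G × F => p.2 + (f (g⁻¹ * x₀) - f (h⁻¹ * x₀))) (x₀, v₀) :=
      ((continuous_of_discreteTopology (f := fun v : F =>
        v + (f (g⁻¹ * x₀) - f (h⁻¹ * x₀)))).comp continuous_snd).continuousAt
    refine hc.congr ?_
    have hgx := eventually_apply_inv_mul (hUo.mem_nhds h1) hf hg
    have hhx := eventually_apply_inv_mul (hUo.mem_nhds h1) hf hh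
    filter_upwards [(continuous_fst.tendsto (x₀, v₀)).eventually hgx,
      (continuous_fst.tendsto (x₀, v₀)).eventually hhx] with p h1 h2
    rw [h1, h2]
    abel
  coordChange_comp i j k x _ v := by abel

/-- The principle of monodromy: a local homomorphism on a simply connected group extends to a
homomorphism. -/
theorem exists_hom_of_local_additive [IsTopologicalGroup G] [SimplyConnectedSpace G]
    [LocallyPathConnectedSpace G] {f : G → F}
    (hf : ∀ᶠ p in 𝓝 (1 : G × G), f (p.1 * p.2) = f p.1 + f p.2) :
    ∃ Φ : G → F, (∀ x y, Φ (x * y) = Φ x + Φ y) ∧ Φ =ᶠ[𝓝 1] f := by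
  obtain ⟨U₁, hU₁, U₂, hU₂, hU⟩ := mem_nhds_prod_iff.1 hf
  obtain ⟨U, hUsub, hUo, h1⟩ := mem_nhds_iff.1 (inter_mem hU₁ hU₂)
  have hfU : ∀ x ∈ U, ∀ y ∈ U, f (x * y) = f x + f y := fun x hx y hy =>
    hU (Set.mk_mem_prod (hUsub hx).1 (hUsub hy).2)
  -- Discrete fibres turn the bundle into a covering; simple connectedness then lifts the identity
  -- of `G` to a global section.
  let _ : TopologicalSpace F := ⊥
  have _ : DiscreteTopology F := ⟨rfl⟩
  have hf1 : f 1 = 0 := by simpa using hfU 1 h1 1 h1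
  let Z := localHomBundle hUo h1 hfU
  have hcov : IsCoveringMap (Z.proj) := FiberBundle.isCoveringMap (F := F) (E := Z.Fiber)
  obtain ⟨s, ⟨hs1, hs⟩, -⟩ := hcov.existsUnique_continuousMap_lifts (ContinuousMap.id G) 1
    (⟨1, (0 : F)⟩ : Z.TotalSpace) rfl
  have hproj : ∀ x, (s x).1 = x := fun x => congrFun hs x
  let Ψ : G → F := fun x => (s x).2
  have hΨ1 : Ψ 1 = 0 := by change (s 1).2 = (0 : F); rw [hs1]
  have hloc : ∀ g, ∀ᶠ x in 𝓝 g, Ψ x = Ψ g + f (g⁻¹ * x) := by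
    intro g
    have hmem : s g ∈ (Z.localTriv g).source := by
      rw [Z.mem_localTriv_source, hproj]; exact Z.mem_baseSet_at g
    have hc : ContinuousAt (fun x => (Z.localTriv g (s x)).2) g :=
      (((Z.localTriv g).toOpenPartialHomeomorph.continuousAt hmem).comp
        s.continuous.continuousAt).snd
    have hval : ∀ x, (Z.localTriv g (s x)).2 = Ψ x + (f 1 - f (g⁻¹ * x)) := by
      intro x
      change Ψ x + (f ((s x).1⁻¹ * (s x).1) - f (g⁻¹ * (s x).1)) = _
      rw [hproj, inv_mul_cancel]
    have : ∀ᶠ x in 𝓝 g, (Z.localTriv g (s x)).2 = (Z.localTriv g (s g)).2 :=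
      hc.eventually (IsOpen.mem_nhds (isOpen_discrete {(Z.localTriv g (s g)).2}) rfl)
    filter_upwards [this] with x hx
    rw [hval, hval, hf1, inv_mul_cancel, hf1] at hx
    simp only [zero_sub, sub_zero, add_zero] at hx
    rw [← hx]
    abel
  refine ⟨Ψ, fun x y => ?_, ?_⟩
  -- Near any `g`, both terms vary by the same amount `f (g⁻¹ y)`.
  · have hconst : IsLocallyConstant (fun y => Ψ (x * y) - Ψ y) := by
      rw [IsLocallyConstant.iff_eventually_eq]
      intro g
      filter_upwards [hloc g, ((continuous_const_mul x).tendsto g).eventually (hloc (x * g))]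
        with y h1 h2
      rw [h1, h2]
      have : (x * g)⁻¹ * (x * y) = g⁻¹ * y := by group
      rw [this]
      abel
    have := hconst.apply_eq_of_preconnectedSpace y 1
    simp only [mul_one, hΨ1, sub_zero] at this
    rw [← this]
    abel
  · filter_upwards [hloc 1] with x hx
    simpa [hΨ1] using hx

end Monodromy

/-! ### Homomorphisms from topological groups to additive groups -/

section Homs

variable {G F : Type*} [TopologicalSpace G] [Group G] [AddCommGroup F]

omit [TopologicalSpace G] in
theorem map_one_eq_zero_of_map_mul {Φ : G → F} (hΦ : ∀ x y, Φ (x * y) = Φ x + Φ y) : Φ 1 = 0 := by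
  simpa using hΦ 1 1

omit [TopologicalSpace G] in
theorem map_inv_eq_neg_of_map_mul {Φ : G → F} (hΦ : ∀ x y, Φ (x * y) = Φ x + Φ y) (x : G) :
    Φ x⁻¹ = -Φ x := by
  have := hΦ x⁻¹ x
  rw [inv_mul_cancel, map_one_eq_zero_of_map_mul hΦ] at this
  exact eq_neg_of_add_eq_zero_left this.symm

theorem tendsto_inv_mul_nhds_one [ContinuousMul G] (g : G) :
    Tendsto (fun x => g⁻¹ * x) (𝓝 g) (𝓝 1) := by
  simpa using (continuous_const_mul g⁻¹).tendsto g

theorem continuous_of_map_mul [ContinuousMul G] [TopologicalSpace F] [ContinuousAdd F]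
    {Φ : G → F} (hΦ : ∀ x y, Φ (x * y) = Φ x + Φ y) (h1 : ContinuousAt Φ 1) : Continuous Φ := by
  rw [continuous_iff_continuousAt]
  intro g
  have h2 : Tendsto (fun x => Φ g + Φ (g⁻¹ * x)) (𝓝 g) (𝓝 (Φ g + Φ 1)) :=
    tendsto_const_nhds.add (h1.tendsto.comp (tendsto_inv_mul_nhds_one g))
  simp only [← hΦ, mul_one, mul_inv_cancel_left] at h2
  exact h2

theorem map_mul_eq_zero_of_eventually [ContinuousMul G] [PreconnectedSpace G]
    {Φ : G → F} (hΦ : ∀ x y, Φ (x * y) = Φ x + Φ y) (h1 : ∀ᶠ x in 𝓝 1, Φ x = 0) (x : G) :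
    Φ x = 0 := by
  have hloc : IsLocallyConstant Φ := by
    rw [IsLocallyConstant.iff_eventually_eq]
    intro g
    filter_upwards [(tendsto_inv_mul_nhds_one g).eventually h1] with x hx
    have := hΦ g (g⁻¹ * x)
    rwa [mul_inv_cancel_left, hx, add_zero] at this
  rw [hloc.apply_eq_of_preconnectedSpace x 1, map_one_eq_zero_of_map_mul hΦ]

/-- Such a subgroup is open, hence closed, and connectedness concludes. -/
theorem Subgroup.eq_top_of_mem_nhds_one [IsTopologicalGroup G] [PreconnectedSpace G]
    {H : Subgroup G} (h : (H : Set G) ∈ 𝓝 1) : H = ⊤ := by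
  have ho := H.isOpen_of_mem_nhds h
  have hc := H.isClosed_of_isOpen ho
  rw [← SetLike.coe_set_eq, Subgroup.coe_top]
  exact IsClopen.eq_univ ⟨hc, ho⟩ ⟨1, H.one_mem⟩

end Homs

/-! ### Homomorphisms and their differentials -/

namespace IsLieChart

variable {E G : Type*} [NormedAddCommGroup E] [NormedSpace ℝ E] [TopologicalSpace G] [Group G]
  [IsTopologicalGroup G] {φ : OpenPartialHomeomorph G E}

/-- Left translates of the single chart form a topological atlas. -/
theorem locallyPathConnectedSpace (hφ : IsLieChart φ) : LocallyPathConnectedSpace G := by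
  let e : G → OpenPartialHomeomorph G E := fun g =>
    (Homeomorph.mulLeft g⁻¹).toOpenPartialHomeomorph.trans φ
  let _ : ChartedSpace E G :=
    { atlas := range e
      chartAt := e
      mem_chart_source := fun g => by simp [e, hφ.one_mem]
      chart_mem_atlas := fun g => ⟨g, rfl⟩ }
  exact ChartedSpace.locallyPathConnectedSpace E G

variable {F : Type*} [NormedAddCommGroup F] [NormedSpace ℝ F]

/-- On a simply connected group, a linear map invariant under the adjoint action integrates to a
homomorphism. -/
theorem exists_hom [SimplyConnectedSpace G] [CompleteSpace F] (hφ : IsLieChart φ)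
    {q : E →L[ℝ] F} (hq : ∀ g, q ∘L chartAd φ g = q) :
    ∃ Φ : G → F, (∀ x y, Φ (x * y) = Φ x + Φ y) ∧ Continuous Φ ∧
      ContDiffAt ℝ 2 (Φ ∘ φ.symm) 0 ∧ HasFDerivAt (Φ ∘ φ.symm) q 0 := by
  have := hφ.locallyPathConnectedSpace
  obtain ⟨f, hf0, hfc, hfd, hf⟩ := hφ.exists_local_additive hq
  obtain ⟨Φ, hΦ, hΦf⟩ := exists_hom_of_local_additive (f := f ∘ φ) (G := G) (by
    have h1 : Tendsto (fun p : G × G => p.1) (𝓝 1) (𝓝 1) := continuous_fst.tendsto (1 : G × G)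
    have h2 : Tendsto (fun p : G × G => p.2) (𝓝 1) (𝓝 1) := continuous_snd.tendsto (1 : G × G)
    have h12 := (hφ.tendsto_one.comp h1).prodMk_nhds (hφ.tendsto_one.comp h2)
    filter_upwards [h12.eventually hf, hφ.eventually_mem_source h1, hφ.eventually_mem_source h2]
      with p hp e1 e2
    simp only [Function.comp_apply, e1, e2] at hp
    exact hp)
  have heq : Φ ∘ φ.symm =ᶠ[𝓝 0] f := by
    filter_upwards [hφ.tendsto_symm.eventually hΦf, hφ.eventually_mem_target tendsto_id]
      with x hx e
    simp only [Function.comp_apply, id] at hx e ⊢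
    rw [hx, e]
  refine ⟨Φ, hΦ, continuous_of_map_mul hΦ ?_, hfc.congr_of_eventuallyEq heq,
    hfd.congr_of_eventuallyEq heq⟩
  have : ContinuousAt (f ∘ φ) 1 := by
    refine ContinuousAt.comp ?_ (φ.continuousAt hφ.one_mem)
    rw [hφ.map_one]; exact hfc.continuousAt
  exact this.congr (EventuallyEq.symm hΦf)

/-- A homomorphism with vanishing differential at the identity vanishes. -/
theorem hom_eq_zero [PreconnectedSpace G] (hφ : IsLieChart φ)
    {Φ : G → F} (hΦ : ∀ x y, Φ (x * y) = Φ x + Φ y)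
    (hd : HasFDerivAt (Φ ∘ φ.symm) (0 : E →L[ℝ] F) 0) (x : G) : Φ x = 0 := by
  refine map_mul_eq_zero_of_eventually hΦ ?_ x
  -- The identity `Φ(z) = Φ(x) + Φ(x⁻¹ z)` carries the vanishing of the differential from the
  -- identity to nearby points.
  have hid : ∀ᶠ p in 𝓝 (0 : E × E), Φ (φ.symm p.2) =
      Φ (φ.symm p.1) + Φ (φ.symm (φ (φ.symm (φ (φ.symm p.1)⁻¹) * φ.symm p.2))) := by
    have h1 := hφ.tendsto_symm_comp (x₀ := (0 : E × E)) (u := fun p => p.1) (by fun_prop) rfl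
    have h2 := hφ.tendsto_symm_comp (x₀ := (0 : E × E)) (u := fun p => p.2) (by fun_prop) rfl
    have h1' := h1.inv
    have h12 := h1'.mul h2
    simp only [mul_one, inv_one] at h1' h12
    filter_upwards [hφ.eventually_mem_source h1', hφ.eventually_mem_source h12] with p e1 e2
    rw [e1, e2, ← hΦ, mul_inv_cancel_left]
  have hdiag : Tendsto (fun x : E => (x, x)) (𝓝 0) (𝓝 (0 : E × E)) := by
    have : Continuous fun x : E => (x, x) := by fun_prop
    exact this.tendsto 0
  have hder : ∀ᶠ x in 𝓝 (0 : E), HasFDerivAt (Φ ∘ φ.symm) (0 : E →L[ℝ] F) x := by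
    filter_upwards [hdiag.eventually hid.eventually_nhds, hφ.eventually_hasFDerivAt_leftLog,
      hφ.eventually_mem_source hφ.tendsto_symm_inv] with x hx hl hi
    have hz : ∀ᶠ z in 𝓝 x, _ :=
      ((show Continuous (fun z : E => (x, z)) by fun_prop).tendsto x).eventually hx
    have h0 : φ (φ.symm (φ (φ.symm x)⁻¹) * φ.symm x) = 0 := by
      rw [hi, inv_mul_cancel, hφ.map_one]
    have hd' := hd
    rw [← h0] at hd'
    have h1 := (hd'.comp x hl.1).const_add (Φ (φ.symm x))
    rw [ContinuousLinearMap.zero_comp] at h1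
    exact h1.congr_of_eventuallyEq hz
  obtain ⟨r, hr, hball⟩ := Metric.eventually_nhds_iff_ball.1 hder
  have hzero : ∀ z ∈ Metric.ball (0 : E) r, Φ (φ.symm z) = 0 := by
    intro z hz
    have := (convex_ball (0 : E) r).is_const_of_fderivWithin_eq_zero (𝕜 := ℝ)
      (f := Φ ∘ φ.symm)
      (fun x hx => (hball x hx).differentiableAt.differentiableWithinAt)
      (fun x hx => by
        rw [fderivWithin_of_isOpen Metric.isOpen_ball hx]; exact (hball x hx).fderiv)
      hz (Metric.mem_ball_self hr)
    simpa [hφ.symm_zero, map_one_eq_zero_of_map_mul hΦ] using this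
  filter_upwards [hφ.tendsto_one.eventually (Metric.ball_mem_nhds 0 hr),
    hφ.eventually_mem_source tendsto_id] with y hy e
  have := hzero _ hy
  rwa [show φ.symm (φ y) = y from e] at this

/-! #### The commutator subgroup -/

omit [IsTopologicalGroup G] in
theorem hasStrictFDerivAt_mul (hφ : IsLieChart φ) :
    HasStrictFDerivAt (fun p : E × E => φ (φ.symm p.1 * φ.symm p.2))
      (ContinuousLinearMap.fst ℝ E E + ContinuousLinearMap.snd ℝ E E) 0 := by
  have h := hφ.contDiffAt_mul.hasStrictFDerivAt (by simp)
  have h1 := HasFDerivAt.comp (f := fun x : E => (x, (0 : E))) (0 : E) h.hasFDerivAt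
    (hasFDerivAt_prodMk_left (𝕜 := ℝ) (0 : E) (0 : E))
  have h1' : HasFDerivAt (fun x : E => φ (φ.symm x * φ.symm 0))
      (fderiv ℝ (fun p : E × E => φ (φ.symm p.1 * φ.symm p.2)) 0 ∘L
        ContinuousLinearMap.inl ℝ E E) 0 := h1
  have h2 := HasFDerivAt.comp (f := fun x : E => ((0 : E), x)) (0 : E) h.hasFDerivAt
    (hasFDerivAt_prodMk_right (𝕜 := ℝ) (0 : E) (0 : E))
  have h2' : HasFDerivAt (fun x : E => φ (φ.symm 0 * φ.symm x))
      (fderiv ℝ (fun p : E × E => φ (φ.symm p.1 * φ.symm p.2)) 0 ∘L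
        ContinuousLinearMap.inr ℝ E E) 0 := h2
  have e1 := h1'.unique ((hasFDerivAt_id (0 : E)).congr_of_eventuallyEq hφ.eventually_mul_zero)
  have e2 := h2'.unique ((hasFDerivAt_id (0 : E)).congr_of_eventuallyEq (by
    filter_upwards [hφ.eventually_mem_target tendsto_id] with x hx
    simpa [hφ.symm_zero] using hx))
  convert! h using 1
  ext v
  · simpa using (congrArg (fun T => T v) e1).symm
  · simpa using (congrArg (fun T => T v) e2).symm

omit [IsTopologicalGroup G] in
theorem hasStrictFDerivAt_mul_comp (hφ : IsLieChart φ) {V : Type*} [NormedAddCommGroup V]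
    [NormedSpace ℝ V] {a b : V → E} {a' b' : V →L[ℝ] E} {v : V} (ha : HasStrictFDerivAt a a' v)
    (hb : HasStrictFDerivAt b b' v) (ha0 : a v = 0) (hb0 : b v = 0) :
    HasStrictFDerivAt (fun y => φ (φ.symm (a y) * φ.symm (b y))) (a' + b') v := by
  have hm := hφ.hasStrictFDerivAt_mul
  rw [show (0 : E × E) = (a v, b v) by rw [ha0, hb0]; rfl] at hm
  have h := hm.comp v (ha.prodMk hb)
  have h' : HasStrictFDerivAt (fun y => φ (φ.symm (a y) * φ.symm (b y))) _ v := h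
  convert! h' using 1

theorem hasStrictFDerivAt_inv (hφ : IsLieChart φ) :
    HasStrictFDerivAt (fun x : E => φ (φ.symm x)⁻¹) (-ContinuousLinearMap.id ℝ E) 0 := by
  have h := hφ.contDiffAt_inv.hasStrictFDerivAt (by simp)
  have h1 := (hφ.hasStrictFDerivAt_mul_comp (hasStrictFDerivAt_id (0 : E)) h rfl
    hφ.inv_zero).hasFDerivAt
  have h2 : (fun x : E => φ (φ.symm x * φ.symm (φ (φ.symm x)⁻¹))) =ᶠ[𝓝 0] fun _ => 0 := by
    filter_upwards [hφ.eventually_mem_source hφ.tendsto_symm_inv] with x hx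
    rw [hx, mul_inv_cancel, hφ.map_one]
  have e := h1.unique ((hasFDerivAt_const (0 : E) (0 : E)).congr_of_eventuallyEq h2)
  convert! h using 1
  ext v
  have := congrArg (fun T => T v) e
  simp only [add_apply, zero_apply] at this
  simpa using neg_eq_of_add_eq_zero_right this

end IsLieChart

universe u v

/-- `S` is contained in the image of the differential of a map into the commutator subgroup. -/
def IsCommutatorTangent {E : Type u} {G : Type v} [NormedAddCommGroup E] [NormedSpace ℝ E]
    [TopologicalSpace G] [Group G] (φ : OpenPartialHomeomorph G E) (S : Submodule ℝ E) : Prop :=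
  ∃ (V : Type u) (_ : NormedAddCommGroup V) (_ : NormedSpace ℝ V) (_ : CompleteSpace V)
    (Ψ : V → E) (Ψ' : V →L[ℝ] E), HasStrictFDerivAt Ψ Ψ' 0 ∧ Ψ 0 = 0 ∧
      (S : Set E) ⊆ range Ψ' ∧ ∀ᶠ y in 𝓝 0, φ.symm (Ψ y) ∈ commutator G

namespace IsLieChart

variable {E : Type u} {G : Type v} [NormedAddCommGroup E] [NormedSpace ℝ E]
  [TopologicalSpace G] [Group G] [IsTopologicalGroup G] {φ : OpenPartialHomeomorph G E}

omit [IsTopologicalGroup G] in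
theorem isCommutatorTangent_bot [CompleteSpace E] (hφ : IsLieChart φ) : IsCommutatorTangent φ ⊥ :=
  ⟨E, inferInstance, inferInstance, inferInstance, fun _ => 0, 0, hasStrictFDerivAt_const _ _, rfl,
    by simp, by simp [hφ.symm_zero]⟩

/-- Multiply the two maps: the differential of the multiplication at the identity is addition. -/
theorem isCommutatorTangent_sup (hφ : IsLieChart φ) {S T : Submodule ℝ E}
    (hS : IsCommutatorTangent φ S) (hT : IsCommutatorTangent φ T) :
    IsCommutatorTangent φ (S ⊔ T) := by
  obtain ⟨V, _, _, _, Ψ, Ψ', h1, h2, h3, h4⟩ := hS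
  obtain ⟨W, _, _, _, Θ, Θ', k1, k2, k3, k4⟩ := hT
  have c1 : Tendsto (fun p : V × W => p.1) (𝓝 0) (𝓝 0) := continuous_fst.tendsto (0 : V × W)
  have c2 : Tendsto (fun p : V × W => p.2) (𝓝 0) (𝓝 0) := continuous_snd.tendsto (0 : V × W)
  have d1 : HasStrictFDerivAt (fun p : V × W => Ψ p.1) (Ψ' ∘L ContinuousLinearMap.fst ℝ V W) 0 :=
    HasStrictFDerivAt.comp (g := Ψ) (0 : V × W) h1 hasStrictFDerivAt_fst
  have d2 : HasStrictFDerivAt (fun p : V × W => Θ p.2) (Θ' ∘L ContinuousLinearMap.snd ℝ V W) 0 :=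
    HasStrictFDerivAt.comp (g := Θ) (0 : V × W) k1 hasStrictFDerivAt_snd
  refine ⟨V × W, inferInstance, inferInstance, inferInstance,
    fun p => φ (φ.symm (Ψ p.1) * φ.symm (Θ p.2)), _, 
    hφ.hasStrictFDerivAt_mul_comp d1 d2 h2 k2, ?_, ?_, ?_⟩
  · simp [h2, k2, hφ.symm_zero, hφ.map_one]
  · rintro x hx
    obtain ⟨s, hs, t, ht, rfl⟩ := Submodule.mem_sup.1 hx
    obtain ⟨a, rfl⟩ := h3 hs
    obtain ⟨b, rfl⟩ := k3 ht
    exact ⟨(a, b), by simp⟩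
  · have e1 : Tendsto (fun p : V × W => φ.symm (Ψ p.1)) (𝓝 0) (𝓝 1) := by
      refine hφ.tendsto_symm.comp ?_
      have := d1.continuousAt.tendsto
      simpa [h2] using this
    have e2 : Tendsto (fun p : V × W => φ.symm (Θ p.2)) (𝓝 0) (𝓝 1) := by
      refine hφ.tendsto_symm.comp ?_
      have := d2.continuousAt.tendsto
      simpa [k2] using this
    have e12 := e1.mul e2
    rw [mul_one] at e12
    filter_upwards [c1.eventually h4, c2.eventually k4, hφ.eventually_mem_source e12]
      with p m1 m2 m3
    rw [m3]
    exact mul_mem m1 m2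

/-- The witness is `y ↦ y (g y⁻¹ g⁻¹) = ⁅y, g⁆`, whose differential is `X ↦ X - Ad(g) X`. -/
theorem isCommutatorTangent_range [CompleteSpace E] (hφ : IsLieChart φ) (g : G) :
    IsCommutatorTangent φ (LinearMap.range
      ((ContinuousLinearMap.id ℝ E - chartAd φ g : E →L[ℝ] E) : E →ₗ[ℝ] E)) := by
  have hi := hφ.hasStrictFDerivAt_inv
  have hc : HasStrictFDerivAt (fun x => φ (g * φ.symm x * g⁻¹)) (chartAd φ g)
      (φ (φ.symm 0)⁻¹) := by
    rw [hφ.inv_zero]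
    exact (hφ.contDiffAt_conj g).hasStrictFDerivAt (by simp)
  have hci := hc.comp (0 : E) hi
  have h0 : φ (g * φ.symm (φ (φ.symm 0)⁻¹) * g⁻¹) = 0 := by
    simp [hφ.symm_zero, hφ.map_one]
  refine ⟨E, inferInstance, inferInstance, inferInstance,
    fun y => φ (φ.symm y * φ.symm (φ (g * φ.symm (φ (φ.symm y)⁻¹) * g⁻¹))), _,
    hφ.hasStrictFDerivAt_mul_comp (hasStrictFDerivAt_id (0 : E)) hci rfl h0, ?_, ?_, ?_⟩
  · beta_reduce
    rw [h0, hφ.mul_zero_zero]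
  · rintro _ ⟨x, rfl⟩
    refine ⟨x, ?_⟩
    simp [sub_eq_add_neg]
  · have h1 := hφ.tendsto_symm_inv
    have h2 : Tendsto (fun y => g * (φ.symm y)⁻¹ * g⁻¹) (𝓝 0) (𝓝 1) := by
      have := (tendsto_const_nhds (x := g)).mul h1 |>.mul (tendsto_const_nhds (x := g⁻¹))
      simpa using this
    have h3 := hφ.tendsto_symm.mul h2
    rw [mul_one] at h3
    filter_upwards [hφ.eventually_mem_source h1, hφ.eventually_mem_source h2,
      hφ.eventually_mem_source h3] with y e1 e2 e3
    rw [e1, e2, e3]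
    have : φ.symm y * (g * (φ.symm y)⁻¹ * g⁻¹) = ⁅φ.symm y, g⁆ := by
      rw [commutatorElement_def]; group
    rw [this]
    exact Subgroup.commutator_mem_commutator (Subgroup.mem_top _) (Subgroup.mem_top _)

/-- In a nontrivial connected solvable group, the vectors `X - Ad(g) X` do not span. -/
theorem iSup_range_chartAd_ne_top [FiniteDimensional ℝ E] [Nontrivial E] [ConnectedSpace G]
    [Group.IsSolvable G] (hφ : IsLieChart φ) :
    ⨆ g : G, LinearMap.range
      ((ContinuousLinearMap.id ℝ E - chartAd φ g : E →L[ℝ] E) : E →ₗ[ℝ] E) ≠ ⊤ := by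
  intro htop
  -- Finite dimension reduces the span to finitely many `g`, so that finitely many commutators have
  -- to be multiplied.
  have hcpt : IsCompactElement (⊤ : Submodule ℝ E) :=
    (Submodule.fg_iff_compact _).1 (IsNoetherian.noetherian _)
  obtain ⟨s, hs⟩ := CompleteLattice.IsCompactElement.exists_finset_of_le_iSup _ hcpt (fun g : G => LinearMap.range
      ((ContinuousLinearMap.id ℝ E - chartAd φ g : E →L[ℝ] E) : E →ₗ[ℝ] E)) htop.ge
  have hfin : ∀ t : Finset G, IsCommutatorTangent φ (⨆ g ∈ t, LinearMap.range
      ((ContinuousLinearMap.id ℝ E - chartAd φ g : E →L[ℝ] E) : E →ₗ[ℝ] E)) := by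
    classical
    intro t
    induction t using Finset.induction_on with
    | empty => simpa using hφ.isCommutatorTangent_bot
    | insert a t _ ih =>
      rw [Finset.iSup_insert]
      exact hφ.isCommutatorTangent_sup (hφ.isCommutatorTangent_range a) ih
  obtain ⟨V, _, _, _, Ψ, Ψ', h1, h2, h3, h4⟩ := hfin s
  have hsurj : LinearMap.range (Ψ' : V →ₗ[ℝ] E) = ⊤ := by
    rw [eq_top_iff]
    intro x hx
    exact h3 (hs hx)
  -- A map with surjective strict differential is open at the point, so the commutators fill a
  -- neighbourhood of the identity.
  have hmap := h1.map_nhds_eq_of_surj hsurj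
  rw [h2] at hmap
  have hE : ∀ᶠ x in 𝓝 (0 : E), φ.symm x ∈ commutator G := by
    rw [← hmap]; exact h4
  have hG : ((commutator G : Subgroup G) : Set G) ∈ 𝓝 1 := by
    filter_upwards [hφ.tendsto_one.eventually hE, hφ.eventually_mem_source tendsto_id] with x hx e
    rwa [show φ.symm (φ x) = x from e] at hx
  have hcomm := Subgroup.eq_top_of_mem_nhds_one hG
  -- The derived subgroup is proper only when `G` is nontrivial; a trivial `G` would force `0` to be
  -- isolated in the nonzero space `E`.
  rcases subsingleton_or_nontrivial G with hsub | hnon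
  · have hz : ∀ᶠ x in 𝓝 (0 : E), x = 0 := by
      filter_upwards [hφ.eventually_mem_target tendsto_id] with x hx
      rw [← show φ (φ.symm x) = x from hx, Subsingleton.elim (φ.symm x) 1, hφ.map_one]
    have hne : (𝓝[≠] (0 : E)).NeBot := Module.punctured_nhds_neBot ℝ E 0
    have hfalse : ∀ᶠ x in 𝓝[≠] (0 : E), False := by
      filter_upwards [hz.filter_mono nhdsWithin_le_nhds, self_mem_nhdsWithin] with x k1 k2
      exact k2 k1
    exact hfalse.exists.choose_spec
  · exact (Group.IsSolvable.commutator_lt_top_of_nontrivial G).ne hcomm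

end IsLieChart

/-- A retract of a simply connected space is simply connected. -/
theorem SimplyConnectedSpace.of_leftInverse {X A : Type*} [TopologicalSpace X] [TopologicalSpace A]
    [SimplyConnectedSpace X] (i : C(A, X)) (r : C(X, A)) (h : ∀ a, r (i a) = a) :
    SimplyConnectedSpace A := by
  rw [simply_connected_iff_paths_homotopic']
  refine ⟨Function.Surjective.pathConnectedSpace (f := r) (fun a => ⟨i a, h a⟩) r.continuous, ?_⟩
  intro x y p q
  have key := ((SimplyConnectedSpace.paths_homotopic (p.map i.continuous)
    (q.map i.continuous)).map r).pathCast (h x).symm (h y).symm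
  convert! key using 1 <;> (ext t; simp [h])

/-! ### Globalising a local section over a normed space -/

section Section

variable {G F : Type*} [TopologicalSpace G] [Group G] [ContinuousMul G]
  [NormedAddCommGroup F] [NormedSpace ℝ F]

/-- The radial retraction onto the closed ball of radius `c`. -/
noncomputable def radialRetraction (c : ℝ) (w : F) : F := (c / max c ‖w‖) • w

theorem radialRetraction_of_norm_le {c : ℝ} {w : F} (h : ‖w‖ ≤ c) : radialRetraction c w = w := by
  rcases eq_or_ne c 0 with rfl | hc
  · have : w = 0 := norm_le_zero_iff.1 h
    simp [radialRetraction, this]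
  · rw [radialRetraction, max_eq_left h, div_self hc, one_smul]

theorem continuous_radialRetraction {c : ℝ} (hc : 0 ≤ c) :
    Continuous (radialRetraction c : F → F) := by
  rcases hc.eq_or_lt with rfl | hc
  · have : (radialRetraction 0 : F → F) = fun _ => 0 := by ext w; simp [radialRetraction]
    rw [this]; exact continuous_const
  · unfold radialRetraction
    refine Continuous.smul (Continuous.div continuous_const (by fun_prop) fun w => ?_) continuous_id
    exact (lt_max_of_lt_left hc).ne'

/-- Both points lie on the ray through `w`, at distances `min c ‖w‖` and `min d ‖w‖` from the
origin. -/
theorem norm_radialRetraction_sub_le {c d : ℝ} (hc : 0 ≤ c) (hcd : c ≤ d) (w : F) :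
    ‖radialRetraction d w - radialRetraction c w‖ ≤ d - c := by
  have key : ∀ c, 0 ≤ c → c / max c ‖w‖ * ‖w‖ = min c ‖w‖ := by
    intro c hc
    rcases le_total ‖w‖ c with h | h
    · rw [max_eq_left h, min_eq_right h]
      rcases hc.eq_or_lt with rfl | hc
      · simp [le_antisymm h (norm_nonneg w)]
      · rw [div_self hc.ne', one_mul]
    · rw [max_eq_right h, min_eq_left h]
      rcases eq_or_ne ‖w‖ 0 with h0 | h0
      · rw [h0] at h ⊢; simp [le_antisymm h hc]
      · rw [div_mul_cancel₀ _ h0]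
  rw [radialRetraction, radialRetraction, ← sub_smul, norm_smul, Real.norm_eq_abs]
  rw [← abs_norm w, ← abs_mul, abs_norm, sub_mul, key c hc, key d (hc.trans hcd), abs_le]
  constructor <;> rcases le_total c ‖w‖ with h | h <;> rcases le_total d ‖w‖ with h' | h' <;>
    simp [h, h'] <;> linarith

/-- Successive approximations to a section of a homomorphism, obtained from a local section. -/
noncomputable def sectionApprox (σ : F → G) (δ : ℝ) : ℕ → F → G
  | 0, _ => 1
  | n + 1, w => sectionApprox σ δ n w *
      σ (radialRetraction ((n + 1 : ℕ) * δ) w - radialRetraction (n * δ) w)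

theorem norm_increment_lt {δ ε : ℝ} (hδ : 0 < δ) (hδε : δ < ε) (n : ℕ) (w : F) :
    ‖radialRetraction ((n + 1 : ℕ) * δ) w - radialRetraction (n * δ) w‖ < ε := by
  refine (norm_radialRetraction_sub_le (by positivity) ?_ w).trans_lt ?_
  · push_cast; nlinarith
  · push_cast; nlinarith

theorem continuous_sectionApprox {σ : F → G} {ε δ : ℝ} (hδ : 0 < δ) (hδε : δ < ε)
    (hσ : ContinuousOn σ (Metric.ball 0 ε)) (n : ℕ) : Continuous (sectionApprox σ δ n) := by
  induction n with
  | zero => exact continuous_const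
  | succ n ih =>
    refine ih.mul (hσ.comp_continuous ?_ fun w => ?_)
    · exact (continuous_radialRetraction (by positivity)).sub
        (continuous_radialRetraction (by positivity))
    · rw [mem_ball_zero_iff]; exact norm_increment_lt hδ hδε n w

omit [TopologicalSpace G] [ContinuousMul G] in
theorem sectionApprox_eq {σ : F → G} {δ : ℝ} (hδ : 0 < δ) (h0 : σ 0 = 1) {n m : ℕ} (hnm : n ≤ m)
    {w : F} (hw : ‖w‖ ≤ n * δ) : sectionApprox σ δ m w = sectionApprox σ δ n w := by
  induction m, hnm using Nat.le_induction with
  | base => rfl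
  | succ m hm ih =>
    have h1 : ‖w‖ ≤ m * δ := hw.trans (by gcongr)
    have h2 : ‖w‖ ≤ (m + 1 : ℕ) * δ := h1.trans (by gcongr; simp)
    rw [sectionApprox, radialRetraction_of_norm_le h1, radialRetraction_of_norm_le h2, sub_self,
      h0, mul_one, ih]

omit [TopologicalSpace G] [ContinuousMul G] in
theorem map_sectionApprox {Φ : G → F} (hΦ : ∀ x y, Φ (x * y) = Φ x + Φ y) {σ : F → G} {ε δ : ℝ}
    (hδ : 0 < δ) (hδε : δ < ε) (hσΦ : ∀ w ∈ Metric.ball (0 : F) ε, Φ (σ w) = w) (n : ℕ) (w : F) :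
    Φ (sectionApprox σ δ n w) = radialRetraction (n * δ) w := by
  induction n with
  | zero => simp [sectionApprox, radialRetraction, map_one_eq_zero_of_map_mul hΦ]
  | succ n ih =>
    rw [sectionApprox, hΦ, ih, hσΦ _ (by
      rw [mem_ball_zero_iff]; exact norm_increment_lt hδ hδε n w)]
    abel

/-- A homomorphism onto a normed space which has a continuous local section has a continuous
section. -/
theorem exists_continuous_section {Φ : G → F} (hΦ : ∀ x y, Φ (x * y) = Φ x + Φ y) {σ : F → G}
    {ε : ℝ} (hε : 0 < ε) (hσ : ContinuousOn σ (Metric.ball 0 ε)) (h0 : σ 0 = 1)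
    (hσΦ : ∀ w ∈ Metric.ball (0 : F) ε, Φ (σ w) = w) :
    ∃ s : F → G, Continuous s ∧ s 0 = 1 ∧ ∀ w, Φ (s w) = w := by
  -- Increments have norm at most `ε / 2`, so they stay inside the ball on which `σ` is a section.
  -- Once `n * (ε / 2)` exceeds `‖w‖`, further factors are `σ 0 = 1`; near a given point a fixed
  -- number of factors thus suffices, whence continuity.
  have hδ : 0 < ε / 2 := by positivity
  have hδε : ε / 2 < ε := by linarith
  have hceil : ∀ w : F, ‖w‖ ≤ (⌈‖w‖ / (ε / 2)⌉₊ : ℝ) * (ε / 2) := fun w => by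
    rw [← div_le_iff₀ hδ]; exact Nat.le_ceil _
  have heq : ∀ (n : ℕ) (w : F), ‖w‖ ≤ n * (ε / 2) →
      sectionApprox σ (ε / 2) ⌈‖w‖ / (ε / 2)⌉₊ w = sectionApprox σ (ε / 2) n w := by
    intro n w hw
    exact (sectionApprox_eq hδ h0 (Nat.ceil_le.2 ((div_le_iff₀ hδ).2 hw)) (hceil w)).symm
  refine ⟨fun w => sectionApprox σ (ε / 2) ⌈‖w‖ / (ε / 2)⌉₊ w, ?_, ?_, fun w => ?_⟩
  · rw [continuous_iff_continuousAt]
    intro w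
    obtain ⟨n, hn⟩ := exists_nat_gt (‖w‖ / (ε / 2))
    rw [div_lt_iff₀ hδ] at hn
    refine ((continuous_sectionApprox hδ hδε hσ n).continuousAt (x := w)).congr ?_
    filter_upwards [continuous_norm.tendsto w |>.eventually (gt_mem_nhds hn)] with v hv
    exact (heq n v hv.le).symm
  · simp [sectionApprox]
  · rw [map_sectionApprox hΦ hδ hδε hσΦ, radialRetraction_of_norm_le (hceil w)]

end Section

/-- The kernel of a homomorphism with a continuous section is a retract. -/
theorem SimplyConnectedSpace.of_section {G F : Type*} [TopologicalSpace G] [Group G]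
    [IsTopologicalGroup G] [SimplyConnectedSpace G] [TopologicalSpace F] [AddCommGroup F]
    {Φ : G → F} (hΦ : ∀ x y, Φ (x * y) = Φ x + Φ y) (hΦc : Continuous Φ) {s : F → G}
    (hs : Continuous s) (hs0 : s 0 = 1) (hsΦ : ∀ w, Φ (s w) = w) {N : Subgroup G}
    (hN : ∀ x, x ∈ N ↔ Φ x = 0) : SimplyConnectedSpace N := by
  refine SimplyConnectedSpace.of_leftInverse (X := G) ⟨Subtype.val, continuous_subtype_val⟩
    ⟨fun x => ⟨x * (s (Φ x))⁻¹, ?_⟩, ?_⟩ ?_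
  · rw [hN, hΦ, map_inv_eq_neg_of_map_mul hΦ, hsΦ, add_neg_cancel]
  · exact Continuous.subtype_mk (continuous_id.mul (hs.comp hΦc).inv) _
  · rintro ⟨x, hx⟩
    ext
    simp [(hN x).1 hx, hs0]

/-! ### Charts adapted to a homomorphism and charts on its kernel -/

namespace IsLieChart

variable {E G F : Type*} [NormedAddCommGroup E] [NormedSpace ℝ E] [TopologicalSpace G] [Group G]
  [NormedAddCommGroup F] [NormedSpace ℝ F] {φ : OpenPartialHomeomorph G E}

theorem trans (hφ : IsLieChart φ) {ψ : OpenPartialHomeomorph E E} (h0 : 0 ∈ ψ.source)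
    (hψ0 : ψ 0 = 0) (hψ : ContDiffAt ℝ 2 ψ 0) (hψs : ContDiffAt ℝ 2 ψ.symm 0) :
    IsLieChart (φ.trans ψ) := by
  have hs0 : ψ.symm 0 = 0 := by
    have := ψ.left_inv h0
    rwa [hψ0] at this
  refine ⟨?_, ?_, ?_, ?_, fun g => ?_⟩
  · simp [hφ.one_mem, hφ.map_one, h0]
  · simp [hφ.map_one, hψ0]
  · have h1 : ContDiffAt ℝ 2 (fun p : E × E => (ψ.symm p.1, ψ.symm p.2)) 0 :=
      (hψs.comp (0 : E × E) contDiffAt_fst).prodMk (hψs.comp (0 : E × E) contDiffAt_snd)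
    have h2 : ContDiffAt ℝ 2 (fun p : E × E => φ (φ.symm (ψ.symm p.1) * φ.symm (ψ.symm p.2))) 0 :=
      ContDiffAt.comp (g := fun p : E × E => φ (φ.symm p.1 * φ.symm p.2)) (0 : E × E)
        (show ContDiffAt ℝ 2 _ (ψ.symm 0, ψ.symm 0) by rw [hs0]; exact hφ.contDiffAt_mul) h1
    exact ContDiffAt.comp (g := ψ) (0 : E × E) (by simpa [hs0, hφ.mul_zero_zero] using hψ) h2
  · have h2 : ContDiffAt ℝ 2 (fun x : E => φ (φ.symm (ψ.symm x))⁻¹) 0 :=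
      ContDiffAt.comp (g := fun x : E => φ (φ.symm x)⁻¹) (0 : E)
        (by simpa [hs0] using hφ.contDiffAt_inv) hψs
    exact ContDiffAt.comp (g := ψ) (0 : E) (show ContDiffAt ℝ 2 ψ (φ (φ.symm (ψ.symm 0))⁻¹) by
      rw [hs0, hφ.inv_zero]; exact hψ) h2
  · have h2 : ContDiffAt ℝ 2 (fun x : E => φ (g * φ.symm (ψ.symm x) * g⁻¹)) 0 :=
      ContDiffAt.comp (g := fun x : E => φ (g * φ.symm x * g⁻¹)) (0 : E)
        (by simpa [hs0] using hφ.contDiffAt_conj g) hψs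
    exact ContDiffAt.comp (g := ψ) (0 : E)
      (by simpa [hs0, hφ.symm_zero, hφ.map_one] using hψ) h2

/-- A homomorphism to a normed space with surjective differential is linear in a suitable chart. -/
theorem exists_adapted_chart [CompleteSpace E] (hφ : IsLieChart φ) {Φ : G → F}
    (hΦ : ∀ x y, Φ (x * y) = Φ x + Φ y) (hΦc : ContDiffAt ℝ 2 (Φ ∘ φ.symm) 0) {q : E →L[ℝ] F}
    (hΦd : HasFDerivAt (Φ ∘ φ.symm) q 0) {j : F →L[ℝ] E} (hj : ∀ w, q (j w) = w) :
    ∃ φ' : OpenPartialHomeomorph G E, IsLieChart φ' ∧ (∀ x ∈ φ'.source, q (φ' x) = Φ x) ∧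
      ∀ α : G → G, α 1 = 1 → DifferentiableAt ℝ (φ ∘ α ∘ φ.symm) 0 →
        DifferentiableAt ℝ (φ' ∘ α ∘ φ'.symm) 0 := by
  -- The correction along the section `j` of `q` gives `q ∘ u = Φ ∘ φ.symm`. It has zero
  -- differential at `0`, so `u` is a local diffeomorphism there.
  let u : E → E := fun x => x + j (Φ (φ.symm x) - q x)
  have hu : ContDiffAt ℝ 2 u 0 :=
    contDiffAt_id.add (j.contDiff.contDiffAt.comp (0 : E) (hΦc.sub q.contDiff.contDiffAt))
  have hud : HasFDerivAt u ((ContinuousLinearEquiv.refl ℝ E : E ≃L[ℝ] E) : E →L[ℝ] E) 0 := by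
    have := (hasFDerivAt_id (0 : E)).add
      (j.hasFDerivAt.comp (0 : E) (hΦd.sub q.hasFDerivAt))
    rw [sub_self, ContinuousLinearMap.comp_zero, add_zero] at this
    exact this
  have hu0 : u 0 = 0 := by simp [u, hφ.symm_zero, map_one_eq_zero_of_map_mul hΦ]
  let ψ := hu.toOpenPartialHomeomorph u hud (by simp)
  have hψ0 : (0 : E) ∈ ψ.source := hu.mem_toOpenPartialHomeomorph_source hud (by simp)
  have hψs : ContDiffAt ℝ 2 ψ.symm 0 := by
    have := hu.to_localInverse hud (by simp)
    rw [hu0] at this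
    exact this
  have hs0 : ψ.symm 0 = 0 := by
    have : ψ.symm (u 0) = 0 := ψ.left_inv hψ0
    rwa [hu0] at this
  refine ⟨φ.trans ψ, hφ.trans hψ0 hu0 hu hψs, fun x hx => ?_, fun α hα hd => ?_⟩
  · have hx' : x ∈ φ.source := by
      rw [OpenPartialHomeomorph.trans_source] at hx; exact hx.1
    change q (φ x + j (Φ (φ.symm (φ x)) - q (φ x))) = Φ x
    rw [map_add, hj, φ.left_inv hx']
    abel
  · have h1 : DifferentiableAt ℝ ((φ ∘ α ∘ φ.symm) ∘ ψ.symm) 0 :=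
      DifferentiableAt.comp (0 : E) (by rwa [hs0]) (hψs.differentiableAt (by simp))
    refine DifferentiableAt.comp (g := u) (0 : E) ?_ h1
    simpa [hs0, hφ.symm_zero, hα, hφ.map_one] using hu.differentiableAt (by simp)

end IsLieChart

section KernelChart

variable {E G F : Type*} [NormedAddCommGroup E] [NormedSpace ℝ E] [TopologicalSpace G] [Group G]
  [NormedAddCommGroup F] [NormedSpace ℝ F]

open Classical in
/-- The chart induced on a subgroup by a chart of the ambient group, with values in a complemented
subspace `V`. -/
noncomputable def subgroupChart (φ : OpenPartialHomeomorph G E) (N : Subgroup G)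
    (V : Submodule ℝ E) (P : E →L[ℝ] V) (hP : ∀ v : V, P v = v)
    (hN : ∀ x ∈ φ.source, x ∈ N ↔ φ x ∈ V) : OpenPartialHomeomorph N V where
  toFun n := P (φ n)
  -- The default `1` is never used on the target: there `φ.symm w` lies in `N` because its
  -- coordinate `w` lies in `V`.
  invFun w := if h : φ.symm w ∈ N then ⟨φ.symm w, h⟩ else 1
  source := Subtype.val ⁻¹' φ.source
  target := Subtype.val ⁻¹' φ.target
  map_source' n hn := by
    have h1 : ((P (φ n) : V) : E) = φ n :=
      congrArg Subtype.val (hP ⟨φ n, (hN n hn).1 n.2⟩)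
    simpa [h1] using φ.map_source hn
  map_target' w hw := by
    have h1 : φ.symm w ∈ N := by
      rw [hN _ (φ.map_target hw), φ.right_inv hw]; exact w.2
    simpa [h1] using φ.map_target hw
  left_inv' n hn := by
    have h1 : ((P (φ n) : V) : E) = φ n :=
      congrArg Subtype.val (hP ⟨φ n, (hN n hn).1 n.2⟩)
    have h2 : φ.symm (φ n) = n := φ.left_inv hn
    ext
    simp [h1, h2]
  right_inv' w hw := by
    have h1 : φ.symm w ∈ N := by
      rw [hN _ (φ.map_target hw), φ.right_inv hw]; exact w.2
    have h2 : φ (φ.symm w) = w := φ.right_inv hw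
    simp [h1, h2, hP]
  open_source := φ.open_source.preimage continuous_subtype_val
  open_target := φ.open_target.preimage continuous_subtype_val
  continuousOn_toFun := P.continuous.comp_continuousOn
    (φ.continuousOn.comp continuous_subtype_val.continuousOn fun _ h => h)
  continuousOn_invFun := by
    rw [Topology.IsInducing.subtypeVal.continuousOn_iff]
    refine (φ.continuousOn_symm.comp continuous_subtype_val.continuousOn fun _ h => h).congr ?_
    intro w hw
    have h1 : φ.symm w ∈ N := by
      rw [hN _ (φ.map_target hw), φ.right_inv hw]; exact w.2
    simp [h1]

variable {φ : OpenPartialHomeomorph G E} {N : Subgroup G} {V : Submodule ℝ E} {P : E →L[ℝ] V}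
  {hP : ∀ v : V, P v = v} {hN : ∀ x ∈ φ.source, x ∈ N ↔ φ x ∈ V}

theorem subgroupChart_apply (n : N) : subgroupChart φ N V P hP hN n = P (φ n) := rfl

theorem coe_subgroupChart_symm {w : V} (hw : (w : E) ∈ φ.target) :
    ((subgroupChart φ N V P hP hN).symm w : G) = φ.symm w := by
  have h1 : φ.symm w ∈ N := by
    rw [hN _ (φ.map_target hw), φ.right_inv hw]; exact w.2
  simp [subgroupChart, h1]

theorem eventually_coe_subgroupChart_symm (hφ : IsLieChart φ) :
    ∀ᶠ w : V in 𝓝 0, ((subgroupChart φ N V P hP hN).symm w : G) = φ.symm w := by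
  have : Tendsto (Subtype.val : V → E) (𝓝 0) (𝓝 0) := continuous_subtype_val.tendsto (0 : V)
  filter_upwards [this.eventually (φ.open_target.mem_nhds hφ.zero_mem)] with w hw
  exact coe_subgroupChart_symm hw

theorem IsLieChart.subgroupChart (hφ : IsLieChart φ) :
    IsLieChart (subgroupChart φ N V P hP hN) := by
  have hs := eventually_coe_subgroupChart_symm (N := N) (V := V) (P := P) (hP := hP) (hN := hN) hφ
  refine ⟨hφ.one_mem, ?_, ?_, ?_, fun g => ?_⟩
  · rw [subgroupChart_apply, Subgroup.coe_one, hφ.map_one, map_zero]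
  · have h : ContDiffAt ℝ 2 (fun p : V × V => P (φ (φ.symm p.1 * φ.symm p.2))) 0 :=
      P.contDiff.contDiffAt.comp (0 : V × V) (ContDiffAt.comp
        (g := fun p : E × E => φ (φ.symm p.1 * φ.symm p.2)) (f := fun p : V × V => ((p.1 : E), (p.2 : E)))
        (0 : V × V) hφ.contDiffAt_mul
        ((V.subtypeL.contDiff.comp contDiff_fst).prodMk
          (V.subtypeL.contDiff.comp contDiff_snd)).contDiffAt)
    refine h.congr_of_eventuallyEq ?_
    filter_upwards [(continuous_fst.tendsto (0 : V × V)).eventually hs,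
      (continuous_snd.tendsto (0 : V × V)).eventually hs] with p h1 h2
    rw [subgroupChart_apply, Subgroup.coe_mul, h1, h2]
  · have h : ContDiffAt ℝ 2 (fun w : V => P (φ (φ.symm w)⁻¹)) 0 :=
      P.contDiff.contDiffAt.comp (0 : V) (ContDiffAt.comp
        (g := fun x : E => φ (φ.symm x)⁻¹) (f := fun w : V => (w : E))
        (0 : V) hφ.contDiffAt_inv V.subtypeL.contDiff.contDiffAt)
    refine h.congr_of_eventuallyEq ?_
    filter_upwards [hs] with p h1
    rw [subgroupChart_apply, Subgroup.coe_inv, h1]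
  · have h : ContDiffAt ℝ 2 (fun w : V => P (φ (g * φ.symm w * (g : G)⁻¹))) 0 :=
      P.contDiff.contDiffAt.comp (0 : V) (ContDiffAt.comp
        (g := fun x : E => φ (g * φ.symm x * (g : G)⁻¹)) (f := fun w : V => (w : E))
        (0 : V) (hφ.contDiffAt_conj g) V.subtypeL.contDiff.contDiffAt)
    refine h.congr_of_eventuallyEq ?_
    filter_upwards [hs] with p h1
    rw [subgroupChart_apply, Subgroup.coe_mul, Subgroup.coe_mul, Subgroup.coe_inv, h1]

theorem IsLieChart.differentiableAt_subgroupChart (hφ : IsLieChart φ) {α : G → G}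
    (hα : DifferentiableAt ℝ (φ ∘ α ∘ φ.symm) 0) {β : N → N} (hβ : ∀ n, (β n : G) = α n) :
    DifferentiableAt ℝ (_root_.subgroupChart φ N V P hP hN ∘ β ∘
      (_root_.subgroupChart φ N V P hP hN).symm) 0 := by
  have hs := eventually_coe_subgroupChart_symm (N := N) (V := V) (P := P) (hP := hP) (hN := hN) hφ
  have h : DifferentiableAt ℝ (fun w : V => P ((φ ∘ α ∘ φ.symm) w)) 0 :=
    P.differentiableAt.comp (0 : V) (DifferentiableAt.comp
      (g := φ ∘ α ∘ φ.symm) (f := fun w : V => (w : E))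
      (0 : V) hα V.subtypeL.differentiableAt)
  refine h.congr_of_eventuallyEq ?_
  filter_upwards [hs] with p h1
  simp only [Function.comp_apply]
  rw [subgroupChart_apply, hβ, h1]

end KernelChart

/-- The kernel of a homomorphism to an additive group. -/
def additiveKernel {G F : Type*} [Group G] [AddCommGroup F] {Φ : G → F}
    (hΦ : ∀ x y, Φ (x * y) = Φ x + Φ y) : Subgroup G where
  carrier := Φ ⁻¹' {0}
  mul_mem' {a b} ha hb := by
    rw [mem_preimage, mem_singleton_iff] at *; rw [hΦ, ha, hb, add_zero]
  one_mem' := map_one_eq_zero_of_map_mul hΦ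
  inv_mem' {a} ha := by
    rw [mem_preimage, mem_singleton_iff] at *; rw [map_inv_eq_neg_of_map_mul hΦ, ha, neg_zero]

/-! ### The characteristic vector quotient -/

namespace IsLieChart

variable {E G : Type*} [NormedAddCommGroup E] [NormedSpace ℝ E] [TopologicalSpace G] [Group G]
  [IsTopologicalGroup G] {φ : OpenPartialHomeomorph G E}

theorem subsingleton_of_subsingleton [Subsingleton E] [PreconnectedSpace G] (hφ : IsLieChart φ) :
    Subsingleton G := by
  have h : ((⊥ : Subgroup G) : Set G) ∈ 𝓝 1 := by
    filter_upwards [hφ.eventually_mem_source tendsto_id] with x hx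
    rw [SetLike.mem_coe, Subgroup.mem_bot, ← show φ.symm (φ x) = x from hx,
      Subsingleton.elim (φ x) 0, hφ.symm_zero]
  have htop := Subgroup.eq_top_of_mem_nhds_one h
  refine ⟨fun x y => ?_⟩
  have hx : x ∈ (⊥ : Subgroup G) := htop ▸ Subgroup.mem_top x
  have hy : y ∈ (⊥ : Subgroup G) := htop ▸ Subgroup.mem_top y
  rw [Subgroup.mem_bot.1 hx, Subgroup.mem_bot.1 hy]

omit [IsTopologicalGroup G] in
theorem eventually_symm_map (hφ : IsLieChart φ) {α : G →* G} (hα : Continuous α) :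
    ∀ᶠ x in 𝓝 (0 : E), φ.symm (φ (α (φ.symm x))) = α (φ.symm x) := by
  have : Tendsto (fun x => α (φ.symm x)) (𝓝 0) (𝓝 1) := by
    have h := hα.tendsto 1
    rw [_root_.map_one] at h
    exact h.comp hφ.tendsto_symm
  exact hφ.eventually_mem_source this

/-- The differential of an endomorphism intertwines the adjoint actions. -/
theorem fderiv_comp_chartAd (hφ : IsLieChart φ) {α : G →* G} (hα : Continuous α)
    (hd : DifferentiableAt ℝ (φ ∘ α ∘ φ.symm) 0) (g : G) :
    fderiv ℝ (φ ∘ α ∘ φ.symm) 0 ∘L chartAd φ g =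
      chartAd φ (α g) ∘L fderiv ℝ (φ ∘ α ∘ φ.symm) 0 := by
  have h1 := hd.hasFDerivAt
  have h2 := hφ.hasFDerivAt_ad g
  have h3 := hφ.hasFDerivAt_ad (α g)
  have e1 : φ (g * φ.symm 0 * g⁻¹) = 0 := by simp [hφ.symm_zero, hφ.map_one]
  have e2 : (φ ∘ α ∘ φ.symm) 0 = 0 := by simp [hφ.symm_zero, hφ.map_one]
  have h12 : HasFDerivAt ((φ ∘ α ∘ φ.symm) ∘ fun x => φ (g * φ.symm x * g⁻¹)) _ 0 :=
    HasFDerivAt.comp (0 : E) (by rw [e1]; exact h1) h2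
  have h31 : HasFDerivAt ((fun x => φ (α g * φ.symm x * (α g)⁻¹)) ∘ (φ ∘ α ∘ φ.symm)) _ 0 :=
    HasFDerivAt.comp (0 : E) (by rw [e2]; exact h3) h1
  refine h12.unique (h31.congr_of_eventuallyEq ?_)
  have hc : Tendsto (fun x => g * φ.symm x * g⁻¹) (𝓝 0) (𝓝 1) := by
    have := (tendsto_const_nhds (x := g)).mul hφ.tendsto_symm |>.mul
      (tendsto_const_nhds (x := g⁻¹))
    simpa using this
  filter_upwards [hφ.eventually_symm_map hα, hφ.eventually_mem_source hc] with x k1 k2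
  simp only [Function.comp_apply]
  rw [k2, k1, map_mul, map_mul, map_inv]

/-- A nontrivial simply connected solvable group with a Lie chart has a characteristic quotient
which is a nontrivial vector group; the kernel is again a simply connected group with a Lie chart,
of smaller dimension. -/
theorem exists_vector_quotient [FiniteDimensional ℝ E] [Nontrivial E] [SimplyConnectedSpace G]
    [Group.IsSolvable G] (hφ : IsLieChart φ) :
    ∃ (F V : Submodule ℝ E) (Φ : G → F), (∀ x y, Φ (x * y) = Φ x + Φ y) ∧ Continuous Φ ∧
      Function.Surjective Φ ∧ Module.finrank ℝ V < Module.finrank ℝ E ∧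
      (∀ α : G →* G, Continuous α → DifferentiableAt ℝ (φ ∘ α ∘ φ.symm) 0 →
        ∃ A : F →ₗ[ℝ] F, ∀ x, Φ (α x) = A (Φ x)) ∧
      ∀ N : Subgroup G, (∀ x, x ∈ N ↔ Φ x = 0) → SimplyConnectedSpace N ∧
        ∃ φN : OpenPartialHomeomorph N V, IsLieChart φN ∧
          ∀ α : G → G, α 1 = 1 → DifferentiableAt ℝ (φ ∘ α ∘ φ.symm) 0 →
            ∀ β : N → N, (∀ n, (β n : G) = α n) →
              DifferentiableAt ℝ (φN ∘ β ∘ φN.symm) 0 := by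
  have hV := hφ.iSup_range_chartAd_ne_top
  set V : Submodule ℝ E := ⨆ g : G, LinearMap.range
      ((ContinuousLinearMap.id ℝ E - chartAd φ g : E →L[ℝ] E) : E →ₗ[ℝ] E) with hVdef
  -- The complement `F` serves as a model of `E / V`, with `q` the projection along `V`.
  obtain ⟨F, hVF⟩ := V.exists_isCompl
  let q : E →L[ℝ] F := LinearMap.toContinuousLinearMap (F.projectionOnto V hVF.symm)
  let P : E →L[ℝ] V := LinearMap.toContinuousLinearMap (V.projectionOnto F hVF)
  have hqF : ∀ w : F, q w = w := fun w => Submodule.projectionOnto_apply_left hVF.symm w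
  have hPV : ∀ w : V, P w = w := fun w => Submodule.projectionOnto_apply_left hVF w
  have hker : ∀ x, q x = 0 ↔ x ∈ V := fun x =>
    Submodule.projectionOnto_apply_eq_zero_iff hVF.symm
  have hAd : ∀ g x, x - chartAd φ g x ∈ V := fun g x =>
    (le_iSup (fun g : G => LinearMap.range
      ((ContinuousLinearMap.id ℝ E - chartAd φ g : E →L[ℝ] E) : E →ₗ[ℝ] E)) g) ⟨x, by simp⟩
  have hq : ∀ g, q ∘L chartAd φ g = q := fun g => by
    ext1 x
    have := (hker _).2 (hAd g x)
    rw [map_sub, sub_eq_zero] at this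
    exact this.symm
  obtain ⟨Φ, hΦ, hΦc, hΦs, hΦd⟩ := hφ.exists_hom hq
  obtain ⟨φ', hφ', hφ'Φ, hφ'α⟩ := hφ.exists_adapted_chart hΦ hΦs hΦd (j := F.subtypeL) hqF
  -- In the adapted chart `Φ` is `q`, so the inverse chart restricted to `F` is a local section.
  obtain ⟨s, hs, hs0, hsΦ⟩ : ∃ s : F → G, Continuous s ∧ s 0 = 1 ∧ ∀ w, Φ (s w) = w := by
    have ht : ∀ᶠ w : F in 𝓝 0, (w : E) ∈ φ'.target :=
      (continuous_subtype_val.tendsto (0 : F)).eventually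
        (φ'.open_target.mem_nhds hφ'.zero_mem)
    obtain ⟨ε, hε, hball⟩ := Metric.eventually_nhds_iff_ball.1 ht
    refine exists_continuous_section hΦ (σ := fun w => φ'.symm w) hε
      (φ'.continuousOn_symm.comp continuous_subtype_val.continuousOn hball) ?_ fun w hw => ?_
    · simp [hφ'.symm_zero]
    · rw [← hφ'Φ _ (φ'.map_target (hball w hw)), φ'.right_inv (hball w hw), hqF]
  refine ⟨F, V, Φ, hΦ, hΦc, fun w => ⟨s w, hsΦ w⟩, Submodule.finrank_lt hV,
    fun α hα hd => ?_, fun N hN => ⟨.of_section hΦ hΦc hs hs0 hsΦ hN, ?_⟩⟩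
  · set a := fderiv ℝ (φ ∘ α ∘ φ.symm) 0 with ha
    -- The differential `a` sends `X - Ad(g) X` to `a X - Ad(α g) (a X)`, hence preserves `V` and
    -- induces `A` on the quotient.
    have haV : ∀ x ∈ V, q (a x) = 0 := by
      have : V ≤ LinearMap.ker ((q ∘L a : E →L[ℝ] F) : E →ₗ[ℝ] F) := by
        refine iSup_le fun g => ?_
        rintro _ ⟨x, rfl⟩
        rw [LinearMap.mem_ker]
        have h1 : a (chartAd φ g x) = chartAd φ (α g) (a x) :=
          congrArg (fun T => T x) (hφ.fderiv_comp_chartAd hα hd g)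
        have h2 : q (chartAd φ (α g) (a x)) = q (a x) := congrArg (fun T => T (a x)) (hq (α g))
        change q (a (x - chartAd φ g x)) = 0
        rw [map_sub, map_sub, h1, h2, sub_self]
      exact fun x hx => this hx
    let A : F →L[ℝ] F := q ∘L a ∘L F.subtypeL
    have hAq : q ∘L a - A ∘L q = 0 := by
      ext1 x
      change q (a x) - q (a (q x : E)) = 0
      rw [← map_sub, ← map_sub]
      refine haV _ ((hker _).1 ?_)
      rw [map_sub, hqF, sub_self]
    refine ⟨A, fun x => ?_⟩
    -- The defect `Φ ∘ α - A ∘ Φ` is a homomorphism with zero differential, so it vanishes by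
    -- `hom_eq_zero`.
    have hΨ : ∀ x y, Φ (α (x * y)) - A (Φ (x * y)) =
        (Φ (α x) - A (Φ x)) + (Φ (α y) - A (Φ y)) := fun x y => by
      rw [map_mul, hΦ, hΦ, map_add]; abel
    have hd1 : HasFDerivAt ((fun x => Φ (α x) - A (Φ x)) ∘ φ.symm) (0 : E →L[ℝ] F) 0 := by
      rw [← hAq]
      have e2 : (φ ∘ α ∘ φ.symm) 0 = 0 := by simp [hφ.symm_zero, hφ.map_one]
      have k1 : HasFDerivAt ((Φ ∘ φ.symm) ∘ (φ ∘ α ∘ φ.symm)) (q ∘L a) 0 :=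
        HasFDerivAt.comp (0 : E) (by rw [e2]; exact hΦd) hd.hasFDerivAt
      refine (k1.sub (A.hasFDerivAt.comp (0 : E) hΦd)).congr_of_eventuallyEq ?_
      filter_upwards [hφ.eventually_symm_map hα] with x hx
      simp [hx]
    exact sub_eq_zero.1 (hφ.hom_eq_zero hΨ hd1 x)
  · have hNV : ∀ x ∈ φ'.source, x ∈ N ↔ φ' x ∈ V := fun x hx => by
      rw [hN, ← hker, hφ'Φ x hx]
    exact ⟨_, hφ'.subgroupChart (hP := hPV) (hN := hNV), fun α hα hd β hβ =>
      hφ'.differentiableAt_subgroupChart (hφ'α α hα hd) hβ⟩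

end IsLieChart

/-! ### Fixed points and compact subgroups, by induction on the dimension -/

/-- An affine map with a periodic orbit has a fixed point. -/
theorem exists_fixed_of_iterate_eq {F : Type*} [AddCommGroup F] [Module ℝ F] (A : F →ₗ[ℝ] F)
    (c : F) {m : ℕ} (hm : 0 < m) (h : (fun w => c + A w)^[m] 0 = 0) : ∃ w, c + A w = w := by
  set S : F → F := fun w => c + A w with hS
  -- This is the barycentre of the orbit of `0`; `S` permutes the orbit cyclically and commutes with
  -- barycentres.
  refine ⟨(m : ℝ)⁻¹ • ∑ i ∈ Finset.range m, S^[i] 0, ?_⟩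
  have hm' : (m : ℝ) ≠ 0 := by exact_mod_cast hm.ne'
  have h1 : ∑ i ∈ Finset.range m, S^[i + 1] 0 = ∑ i ∈ Finset.range m, S^[i] 0 := by
    have e1 := Finset.sum_range_succ (fun i => S^[i] 0) m
    have e2 := Finset.sum_range_succ' (fun i => S^[i] 0) m
    rw [e1, h] at e2
    simpa using e2.symm
  have h2 : ∑ i ∈ Finset.range m, S^[i + 1] 0 =
      (m : ℝ) • c + A (∑ i ∈ Finset.range m, S^[i] 0) := by
    simp only [Function.iterate_succ_apply', hS, Finset.sum_add_distrib, map_sum]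
    simp [← Nat.cast_smul_eq_nsmul ℝ]
  rw [map_smul]
  conv_rhs => rw [← h1, h2, smul_add, smul_smul, inv_mul_cancel₀ hm', one_smul]


/-- An affine transformation of finite order of a simply connected solvable group has a fixed
point. -/
theorem IsLieChart.exists_fixed_point (d : ℕ) : ∀ {E : Type u} {G : Type v} [NormedAddCommGroup E]
    [NormedSpace ℝ E] [FiniteDimensional ℝ E] [TopologicalSpace G] [Group G]
    [IsTopologicalGroup G] [SimplyConnectedSpace G] [Group.IsSolvable G]
    {φ : OpenPartialHomeomorph G E}, IsLieChart φ → Module.finrank ℝ E = d →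
    ∀ {α : G →* G}, Continuous α → DifferentiableAt ℝ (φ ∘ α ∘ φ.symm) 0 →
    ∀ {g : G} {m : ℕ}, 0 < m → (∀ x, (fun x => g * α x)^[m] x = x) → ∃ x, g * α x = x := by
  induction d using Nat.strong_induction_on with
  | _ d ih =>
    -- The group and its model space vary in the induction, since the step passes to the kernel `N`
    -- modelled on `V`.
    intro E G _ _ _ _ _ _ _ _ φ hφ hdim α hα hd g m hm hT
    rcases subsingleton_or_nontrivial E with _ | _
    · have := hφ.subsingleton_of_subsingleton
      exact ⟨1, Subsingleton.elim _ _⟩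
    obtain ⟨F, V, Φ, hΦ, hΦc, hΦs, hVE, hA, hN⟩ := hφ.exists_vector_quotient
    obtain ⟨A, hAα⟩ := hA α hα hd
    have hsemi : Function.Semiconj Φ (fun x => g * α x) (fun w => Φ g + A w) := fun x => by
      change Φ (g * α x) = Φ g + A (Φ x)
      rw [hΦ, hAα]
    obtain ⟨w, hw⟩ := exists_fixed_of_iterate_eq A (Φ g) hm (by
      have := (hsemi.iterate_right m) 1
      rw [hT, map_one_eq_zero_of_map_mul hΦ] at this
      exact this.symm)
    obtain ⟨x₀, rfl⟩ := hΦs w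
    let N : Subgroup G := additiveKernel hΦ
    obtain ⟨_, φN, hφN, hφNα⟩ := hN N fun _ => Iff.rfl
    have hαN : ∀ n : N, α n ∈ N := fun n => by
      change Φ (α n) = 0
      rw [hAα, show Φ (n : G) = 0 from n.2, map_zero]
    let β : N →* N := (α.comp N.subtype).codRestrict N hαN
    -- The map preserves the fibre `x₀ N` over the fixed point. Translated by `x₀`, its restriction
    -- becomes an affine map of `N` with linear part `β`, again of finite order.
    have hn₀ : x₀⁻¹ * (g * α x₀) ∈ N := by
      change Φ _ = 0
      rw [hΦ, hΦ, hAα, hw, map_inv_eq_neg_of_map_mul hΦ, neg_add_cancel]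
    have hsemi' : Function.Semiconj (fun n : N => x₀ * n)
        (fun n => ⟨_, hn₀⟩ * β n) (fun x => g * α x) := fun n => by
      change x₀ * (x₀⁻¹ * (g * α x₀) * α n) = g * α (x₀ * n)
      rw [map_mul]; group
    obtain ⟨y, hy⟩ := ih (Module.finrank ℝ V) (hdim ▸ hVE) hφN rfl (α := β) (g := ⟨_, hn₀⟩)
      ((hα.comp continuous_subtype_val).subtype_mk _) (hφNα α (_root_.map_one α) hd β fun _ => rfl) hm
      (fun n => by
        have := (hsemi'.iterate_right m) n
        rw [hT] at this
        exact Subtype.ext (mul_left_cancel this))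
    refine ⟨x₀ * y, ?_⟩
    have := hsemi' y
    beta_reduce at this
    rw [hy] at this
    exact this.symm

/-- A simply connected solvable group has no nontrivial compact subgroups. -/
theorem IsLieChart.eq_bot_of_isCompact (d : ℕ) : ∀ {E : Type u} {G : Type v}
    [NormedAddCommGroup E] [NormedSpace ℝ E] [FiniteDimensional ℝ E] [TopologicalSpace G] [Group G]
    [IsTopologicalGroup G] [SimplyConnectedSpace G] [Group.IsSolvable G]
    {φ : OpenPartialHomeomorph G E}, IsLieChart φ → Module.finrank ℝ E = d →
    ∀ {C : Subgroup G}, IsCompact (C : Set G) → C = ⊥ := by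
  induction d using Nat.strong_induction_on with
  | _ d ih =>
    intro E G _ _ _ _ _ _ _ _ φ hφ hdim C hC
    rcases subsingleton_or_nontrivial E with _ | _
    · have := hφ.subsingleton_of_subsingleton
      exact Subsingleton.elim _ _
    obtain ⟨F, V, Φ, hΦ, hΦc, hΦs, hVE, -, hN⟩ := hφ.exists_vector_quotient
    let N : Subgroup G := additiveKernel hΦ
    obtain ⟨_, φN, hφN, -⟩ := hN N fun _ => Iff.rfl
    -- The image of `C` in the vector group is bounded, while the multiples `k • Φ x` of a nonzero
    -- vector are not.
    have hCN : C ≤ N := by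
      intro x hx
      obtain ⟨R, hR⟩ := (hC.image hΦc).isBounded.exists_norm_le
      have hpow : ∀ k : ℕ, Φ (x ^ k) = k • Φ x := fun k => by
        induction k with
        | zero => simp [map_one_eq_zero_of_map_mul hΦ]
        | succ k ih => rw [pow_succ, hΦ, ih, succ_nsmul]
      by_contra hne
      have hpos : 0 < ‖Φ x‖ := norm_pos_iff.2 hne
      obtain ⟨k, hk⟩ := exists_nat_gt (R / ‖Φ x‖)
      rw [div_lt_iff₀ hpos] at hk
      have := hR _ ⟨x ^ k, C.pow_mem hx k, rfl⟩
      rw [hpow, ← Nat.cast_smul_eq_nsmul ℝ, norm_smul, Real.norm_natCast] at this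
      linarith
    have hCN' : IsCompact ((C.subgroupOf N : Subgroup N) : Set N) := by
      rw [Topology.IsInducing.subtypeVal.isCompact_iff]
      convert hC
      ext x
      constructor
      · rintro ⟨y, hy, rfl⟩; exact hy
      · exact fun hx => ⟨⟨x, hCN hx⟩, hx, rfl⟩
    have := ih (Module.finrank ℝ V) (hdim ▸ hVE) hφN rfl hCN'
    rw [Subgroup.subgroupOf_eq_bot] at this
    exact disjoint_self.1 (this.mono_right hCN)

/-! ### Application to Lie groups -/

section LieGroup

variable {E : Type*} [NormedAddCommGroup E] [NormedSpace ℝ E]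
  {G : Type*} [TopologicalSpace G] [ChartedSpace E G] [Group G] [LieGroup 𝓘(ℝ, E) ∞ G]

variable (E G) in
/-- A Lie group has a Lie chart, in which smooth maps fixing the identity are differentiable. -/
theorem LieGroup.exists_isLieChart : ∃ φ : OpenPartialHomeomorph G E, IsLieChart φ ∧
    ∀ α : G → G, ContMDiff 𝓘(ℝ, E) 𝓘(ℝ, E) ∞ α → α 1 = 1 →
      DifferentiableAt ℝ (φ ∘ α ∘ φ.symm) 0 := by
  let c := chartAt E (1 : G) 1
  let φ : OpenPartialHomeomorph G E :=
    (chartAt E (1 : G)).trans (Homeomorph.addRight (-c)).toOpenPartialHomeomorph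
  have hsymm : ∀ v, φ.symm v = (chartAt E (1 : G)).symm (v + c) := fun v => by
    simp [φ, Homeomorph.addRight_symm]
  have hs0 : φ.symm 0 = 1 := by
    rw [hsymm, zero_add]; exact (chartAt E (1 : G)).left_inv (mem_chart_source E 1)
  have hφ1 : φ 1 = 0 := by simp [φ, c]
  have hφs : ContMDiffAt 𝓘(ℝ, E) 𝓘(ℝ, E) ∞ φ.symm 0 := by
    have h1 : ContMDiffAt 𝓘(ℝ, E) 𝓘(ℝ, E) ∞ (chartAt E (1 : G)).symm (0 + c) :=
      (contMDiffOn_chart_symm (I := 𝓘(ℝ, E)) (n := ∞)).contMDiffAt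
        ((chartAt E (1 : G)).open_target.mem_nhds (by
          rw [zero_add]; exact mem_chart_target E (1 : G)))
    have h2 : ContMDiffAt 𝓘(ℝ, E) 𝓘(ℝ, E) ∞ (fun v : E => v + c) 0 :=
      (contDiff_id.add contDiff_const).contMDiff.contMDiffAt
    exact (h1.comp (0 : E) h2).congr_of_eventuallyEq (Eventually.of_forall hsymm)
  have hφc : ContMDiffAt 𝓘(ℝ, E) 𝓘(ℝ, E) ∞ φ 1 := by
    have h1 : ContMDiffAt 𝓘(ℝ, E) 𝓘(ℝ, E) ∞ (chartAt E (1 : G)) 1 :=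
      (contMDiffOn_chart (I := 𝓘(ℝ, E)) (n := ∞)).contMDiffAt
        ((chartAt E (1 : G)).open_source.mem_nhds (mem_chart_source E 1))
    have h2 : ContMDiffAt 𝓘(ℝ, E) 𝓘(ℝ, E) ∞ (fun v : E => v + -c) (chartAt E (1 : G) 1) :=
      (contDiff_id.add contDiff_const).contMDiff.contMDiffAt
    exact (h2.comp (1 : G) h1)
  have hle : (2 : WithTop ℕ∞) ≤ ∞ := by 
    exact WithTop.coe_le_coe.2 (le_top : (2 : ℕ∞) ≤ ⊤)
  -- smoothness in the chart of a map fixing the identity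
  have key : ∀ α : G → G, α 1 = 1 → ContMDiff 𝓘(ℝ, E) 𝓘(ℝ, E) ∞ α →
      ContDiffAt ℝ 2 (fun x => φ (α (φ.symm x))) 0 := by
    intro α h1 hα
    have h2 : ContMDiffAt 𝓘(ℝ, E) 𝓘(ℝ, E) ∞ (fun x => α (φ.symm x)) 0 :=
      ContMDiffAt.comp (0 : E) hα.contMDiffAt hφs
    have h3 : ContMDiffAt 𝓘(ℝ, E) 𝓘(ℝ, E) ∞ (fun x => φ (α (φ.symm x))) 0 :=
      ContMDiffAt.comp (0 : E) (by rw [hs0, h1]; exact hφc) h2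
    exact h3.contDiffAt.of_le hle
  refine ⟨φ, ⟨by simp [φ], hφ1, ?_, ?_, fun g => ?_⟩, fun α hα h1 =>
    (key α h1 hα).differentiableAt (by simp)⟩
  · have h1 : ContMDiffAt 𝓘(ℝ, E × E) 𝓘(ℝ, E) ∞ (fun p : E × E => φ.symm p.1) 0 :=
      ContMDiffAt.comp (g := φ.symm) (0 : E × E) hφs contDiff_fst.contMDiff.contMDiffAt
    have h2 : ContMDiffAt 𝓘(ℝ, E × E) 𝓘(ℝ, E) ∞ (fun p : E × E => φ.symm p.2) 0 :=
      ContMDiffAt.comp (g := φ.symm) (0 : E × E) hφs contDiff_snd.contMDiff.contMDiffAt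
    have h3 : ContMDiffAt 𝓘(ℝ, E × E) 𝓘(ℝ, E) ∞
        (fun p : E × E => φ (φ.symm p.1 * φ.symm p.2)) 0 :=
      ContMDiffAt.comp (g := φ) (0 : E × E) (by simpa [hs0] using hφc) (h1.mul h2)
    exact h3.contDiffAt.of_le hle
  · exact key (fun x => x⁻¹) inv_one (_root_.contMDiff_inv 𝓘(ℝ, E) ∞)
  · exact key (fun x => g * x * g⁻¹) (by simp)
      ((contMDiff_const.mul contMDiff_id).mul contMDiff_const)

variable [FiniteDimensional ℝ E] [SimplyConnectedSpace G] [Group.IsSolvable G]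

/-- A simply connected solvable Lie group has no nontrivial compact subgroups. -/
theorem LieGroup.eq_bot_of_isCompact (E : Type*) [NormedAddCommGroup E] [NormedSpace ℝ E]
    {G : Type*} [TopologicalSpace G] [ChartedSpace E G] [Group G] [LieGroup 𝓘(ℝ, E) ∞ G]
    [FiniteDimensional ℝ E] [SimplyConnectedSpace G] [Group.IsSolvable G]
    {C : Subgroup G} (hC : IsCompact (C : Set G)) : C = ⊥ := by
  have := topologicalGroup_of_lieGroup 𝓘(ℝ, E) ∞ (G := G)
  obtain ⟨φ, hφ, -⟩ := LieGroup.exists_isLieChart E G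
  exact IsLieChart.eq_bot_of_isCompact _ hφ rfl hC

/-- An affine transformation of finite order of a simply connected solvable Lie group has a fixed
point. -/
theorem Aff.exists_fixed_point {α : MulAut G} (hα : α ∈ LieAut E G) {g : G} {m : ℕ} (hm : 0 < m)
    (hT : ∀ x, (fun x => g * α x)^[m] x = x) : ∃ x, g * α x = x := by
  have := topologicalGroup_of_lieGroup 𝓘(ℝ, E) ∞ (G := G)
  obtain ⟨φ, hφ, hφα⟩ := LieGroup.exists_isLieChart E G
  exact IsLieChart.exists_fixed_point _ hφ rfl (α := α.toMonoidHom) hα.1.continuous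
    (hφα α hα.1 (map_one α)) hm hT

end LieGroup

/-! ### Smooth structures pulled back along a family of local homeomorphisms -/

section ChartedSpaceOfCover

variable {E : Type*} [NormedAddCommGroup E] [NormedSpace ℝ E]
  {X Y : Type*} [TopologicalSpace X] [ChartedSpace E X] [TopologicalSpace Y]

/-- The charted space structure pulled back along a family of open partial homeomorphisms. -/
@[reducible]
noncomputable def chartedSpaceOfCover (S : Set (OpenPartialHomeomorph Y X))
    (hS : ∀ y, ∃ e ∈ S, y ∈ e.source) : ChartedSpace E Y where
  atlas := {d | ∃ e ∈ S, ∃ c ∈ atlas E X, d = e.trans c}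
  chartAt y := (hS y).choose.trans (chartAt E ((hS y).choose y))
  mem_chart_source y := by simp [(hS y).choose_spec.2]
  chart_mem_atlas y := ⟨_, (hS y).choose_spec.1, _, chart_mem_atlas E _, rfl⟩

/-- The members of the family have smooth transition maps. -/
def HasSmoothTransitions (E : Type*) [NormedAddCommGroup E] [NormedSpace ℝ E]
    {X Y : Type*} [TopologicalSpace X] [ChartedSpace E X] [TopologicalSpace Y]
    (S : Set (OpenPartialHomeomorph Y X)) : Prop :=
  ∀ e ∈ S, ∀ e' ∈ S, ∀ x ∈ e.target, e.symm x ∈ e'.source →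
    ContMDiffAt 𝓘(ℝ, E) 𝓘(ℝ, E) ∞ (e' ∘ e.symm) x

variable [IsManifold 𝓘(ℝ, E) ∞ X] {S : Set (OpenPartialHomeomorph Y X)}

/-- A change of charts is `c' ∘ (e' ∘ e.symm) ∘ c.symm`, with charts of `X` at both ends and a
transition of the family in the middle. -/
theorem HasSmoothTransitions.isManifold (h : HasSmoothTransitions E S)
    (hS : ∀ y, ∃ e ∈ S, y ∈ e.source) :
    @IsManifold ℝ _ E _ _ E _ 𝓘(ℝ, E) ∞ Y _ (chartedSpaceOfCover S hS) := by
  let _ : ChartedSpace E Y := chartedSpaceOfCover S hS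
  refine isManifold_of_contDiffOn 𝓘(ℝ, E) ∞ Y ?_
  rintro _ _ ⟨e, he, c, hc, rfl⟩ ⟨e', he', c', hc', rfl⟩ v ⟨hv, -⟩
  simp only [modelWithCornersSelf_coe_symm, mem_preimage, id_eq] at hv
  simp only [OpenPartialHomeomorph.trans_symm_eq_symm_trans_symm,
    OpenPartialHomeomorph.trans_source, OpenPartialHomeomorph.symm_source, mem_inter_iff,
    mem_preimage, OpenPartialHomeomorph.coe_trans, Function.comp_apply] at hv
  obtain ⟨⟨hv1, hv2⟩, hv3, hv4⟩ := hv
  have h1 : ContMDiffAt 𝓘(ℝ, E) 𝓘(ℝ, E) ∞ c.symm v :=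
    contMDiffAt_symm_of_mem_maximalAtlas (IsManifold.subset_maximalAtlas hc) hv1
  have h2 := h e he e' he' (c.symm v) hv2 hv3
  have h3 : ContMDiffAt 𝓘(ℝ, E) 𝓘(ℝ, E) ∞ c' (e' (e.symm (c.symm v))) :=
    contMDiffAt_of_mem_maximalAtlas (IsManifold.subset_maximalAtlas hc') hv4
  have h4 : ContMDiffAt 𝓘(ℝ, E) 𝓘(ℝ, E) ∞ (c' ∘ (e' ∘ e.symm) ∘ c.symm) v :=
    ContMDiffAt.comp (g := c') v h3 (h2.comp v h1)
  exact h4.contDiffAt.contDiffWithinAt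

theorem HasSmoothTransitions.contMDiffAt (h : HasSmoothTransitions E S)
    (hS : ∀ y, ∃ e ∈ S, y ∈ e.source) {e : OpenPartialHomeomorph Y X} (he : e ∈ S) {y : Y}
    (hy : y ∈ e.source) :
    @ContMDiffAt ℝ _ E _ _ E _ 𝓘(ℝ, E) Y _ (chartedSpaceOfCover S hS) E _ _ E _ 𝓘(ℝ, E) X _ _ ∞
      e y := by
  let _ : ChartedSpace E Y := chartedSpaceOfCover S hS
  have := h.isManifold hS
  have hc := chart_mem_atlas E (e y)
  have hd : e.trans (chartAt E (e y)) ∈ atlas E Y := ⟨e, he, _, hc, rfl⟩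
  have h1 : ContMDiffAt 𝓘(ℝ, E) 𝓘(ℝ, E) ∞ (e.trans (chartAt E (e y))) y :=
    contMDiffAt_of_mem_maximalAtlas (IsManifold.subset_maximalAtlas hd) (by simp [hy])
  have h2 : ContMDiffAt 𝓘(ℝ, E) 𝓘(ℝ, E) ∞ (chartAt E (e y)).symm (chartAt E (e y) (e y)) :=
    contMDiffAt_symm_of_mem_maximalAtlas (IsManifold.subset_maximalAtlas hc)
      (mem_chart_target E (e y))
  refine (ContMDiffAt.comp (g := (chartAt E (e y)).symm) y h2 h1).congr_of_eventuallyEq ?_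
  filter_upwards [(e.continuousAt hy).eventually ((chartAt E (e y)).open_source.mem_nhds
    (mem_chart_source E (e y)))] with z hz
  exact ((chartAt E (e y)).left_inv hz).symm

theorem HasSmoothTransitions.contMDiffAt_symm (h : HasSmoothTransitions E S)
    (hS : ∀ y, ∃ e ∈ S, y ∈ e.source) {e : OpenPartialHomeomorph Y X} (he : e ∈ S) {x : X}
    (hx : x ∈ e.target) :
    @ContMDiffAt ℝ _ E _ _ E _ 𝓘(ℝ, E) X _ _ E _ _ E _ 𝓘(ℝ, E) Y _ (chartedSpaceOfCover S hS) ∞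
      e.symm x := by
  let _ : ChartedSpace E Y := chartedSpaceOfCover S hS
  have := h.isManifold hS
  have hc := chart_mem_atlas E x
  have hd : e.trans (chartAt E x) ∈ atlas E Y := ⟨e, he, _, hc, rfl⟩
  have h1 : ContMDiffAt 𝓘(ℝ, E) 𝓘(ℝ, E) ∞ (chartAt E x) x :=
    contMDiffAt_of_mem_maximalAtlas (IsManifold.subset_maximalAtlas hc) (mem_chart_source E x)
  have h2 : ContMDiffAt 𝓘(ℝ, E) 𝓘(ℝ, E) ∞ (e.trans (chartAt E x)).symm (chartAt E x x) :=
    contMDiffAt_symm_of_mem_maximalAtlas (IsManifold.subset_maximalAtlas hd) (by simp [hx])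
  refine (ContMDiffAt.comp (g := (e.trans (chartAt E x)).symm) x h2 h1).congr_of_eventuallyEq ?_
  filter_upwards [(chartAt E x).open_source.mem_nhds (mem_chart_source E x)] with z hz
  simp [(chartAt E x).left_inv hz]

/-- The members of the family are diffeomorphisms between open sets. -/
noncomputable def HasSmoothTransitions.toPartialDiffeomorph (h : HasSmoothTransitions E S)
    (hS : ∀ y, ∃ e ∈ S, y ∈ e.source) {e : OpenPartialHomeomorph Y X} (he : e ∈ S) :
    @PartialDiffeomorph ℝ _ E _ _ E _ _ E _ E _ 𝓘(ℝ, E) 𝓘(ℝ, E) Y _ (chartedSpaceOfCover S hS)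
      X _ _ ∞ :=
  let _ : ChartedSpace E Y := chartedSpaceOfCover S hS
  { e with
    contMDiffOn_toFun := fun _ hy => (h.contMDiffAt hS he hy).contMDiffWithinAt
    contMDiffOn_invFun := fun _ hx => (h.contMDiffAt_symm hS he hx).contMDiffWithinAt }

/-- The members of the family are local diffeomorphisms. -/
theorem HasSmoothTransitions.isLocalDiffeomorphAt (h : HasSmoothTransitions E S)
    (hS : ∀ y, ∃ e ∈ S, y ∈ e.source) {e : OpenPartialHomeomorph Y X} (he : e ∈ S) {y : Y}
    (hy : y ∈ e.source) :
    @IsLocalDiffeomorphAt ℝ _ E _ _ E _ _ E _ E _ 𝓘(ℝ, E) 𝓘(ℝ, E) Y _ (chartedSpaceOfCover S hS)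
      X _ _ ∞ e y :=
  ⟨h.toPartialDiffeomorph hS he, hy, fun _ _ => rfl⟩

theorem HasSmoothTransitions.isLocalDiffeomorphAt_symm (h : HasSmoothTransitions E S)
    (hS : ∀ y, ∃ e ∈ S, y ∈ e.source) {e : OpenPartialHomeomorph Y X} (he : e ∈ S) {x : X}
    (hx : x ∈ e.target) :
    @IsLocalDiffeomorphAt ℝ _ E _ _ E _ _ E _ E _ 𝓘(ℝ, E) 𝓘(ℝ, E) X _ _ Y _
      (chartedSpaceOfCover S hS) ∞ e.symm x :=
  let _ : ChartedSpace E Y := chartedSpaceOfCover S hS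
  ⟨(h.toPartialDiffeomorph hS he).symm, hx, fun _ _ => rfl⟩

omit [IsManifold 𝓘(ℝ, E) ∞ X] in
/-- The family consisting of a single homeomorphism. -/
theorem hasSmoothTransitions_singleton (e : Y ≃ₜ X) :
    HasSmoothTransitions E {e.toOpenPartialHomeomorph} := by
  rintro _ rfl _ rfl x _ _
  refine (contMDiffAt_id (I := 𝓘(ℝ, E)) (n := ∞) (x := x)).congr_of_eventuallyEq ?_
  filter_upwards with z
  simp

end ChartedSpaceOfCover

/-! ### Quotients by free properly discontinuous smooth actions -/

section Quotient

variable {E : Type*} [NormedAddCommGroup E] [NormedSpace ℝ E]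
  {X Y : Type*} [TopologicalSpace X] [ChartedSpace E X] [TopologicalSpace Y]

/-- The local inverses of a map. -/
def localInverses (π : X → Y) : Set (OpenPartialHomeomorph Y X) :=
  {e | ⇑e.symm = π}

theorem exists_mem_localInverses {π : X → Y} (hπ : IsLocalHomeomorph π)
    (hsurj : Function.Surjective π) (y : Y) : ∃ e ∈ localInverses π, y ∈ e.source := by
  obtain ⟨x, rfl⟩ := hsurj y
  obtain ⟨e, hx, he⟩ := hπ x
  refine ⟨e.symm, he.symm, ?_⟩
  rw [he]
  exact e.map_source hx

/-- Two local inverses of `π` differ locally by one of the smooth maps `f` over `Y`: injectivity of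
`π` on the target of `e'` forces the transition to agree with `f` near `x`. -/
theorem hasSmoothTransitions_localInverses {π : X → Y}
    (htrans : ∀ x x', π x = π x' → ∃ f : X → X, ContMDiff 𝓘(ℝ, E) 𝓘(ℝ, E) ∞ f ∧ f x = x' ∧
      ∀ z, π (f z) = π z) : HasSmoothTransitions E (localInverses π) := by
  intro e he e' he' x hx hx'
  have hπe : ∀ z ∈ e.source, π (e z) = z := fun z hz => by
    rw [← show ⇑e.symm = π from he]; exact e.left_inv hz
  have hπe' : ∀ z ∈ e'.source, π (e' z) = z := fun z hz => by
    rw [← show ⇑e'.symm = π from he']; exact e'.left_inv hz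
  have hex : e.symm x = π x := congrFun he x
  obtain ⟨f, hf, hfx, hfπ⟩ := htrans x (e' (e.symm x)) (by rw [hπe' _ hx', hex])
  refine (hf x).congr_of_eventuallyEq ?_
  have h1 : ∀ᶠ z in 𝓝 x, f z ∈ e'.target := by
    refine hf.continuous.continuousAt.eventually (e'.open_target.mem_nhds ?_)
    rw [hfx]; exact e'.map_source hx'
  filter_upwards [h1] with z hz
  have h2 : e'.symm (f z) = π z := by rw [← hfπ z]; exact congrFun he' (f z)
  have h3 : e.symm z = π z := congrFun he z
  rw [Function.comp_apply, h3, ← h2, e'.right_inv hz]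

end Quotient

/-! ### Topology of semidirect products -/

namespace SemidirectProduct

variable {N H : Type*} [Group N] [Group H] {φ : H →* MulAut N}
  [TopologicalSpace N] [TopologicalSpace H]

/-- A semidirect product is homeomorphic to the product of its factors. -/
def homeomorphProd : N ⋊[φ] H ≃ₜ N × H where
  toFun x := (x.left, x.right)
  invFun p := ⟨p.1, p.2⟩
  left_inv _ := rfl
  right_inv _ := rfl
  continuous_toFun := continuous_induced_dom
  continuous_invFun := continuous_induced_rng.2 continuous_id

theorem continuous_left : Continuous (SemidirectProduct.left : N ⋊[φ] H → N) :=
  continuous_fst.comp (homeomorphProd (φ := φ)).continuous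

theorem continuous_right : Continuous (SemidirectProduct.right : N ⋊[φ] H → H) :=
  continuous_snd.comp (homeomorphProd (φ := φ)).continuous

theorem continuous_mk {X : Type*} [TopologicalSpace X] {f : X → N} {g : X → H} (hf : Continuous f)
    (hg : Continuous g) : Continuous (fun x => (⟨f x, g x⟩ : N ⋊[φ] H)) :=
  (homeomorphProd (φ := φ)).symm.continuous.comp (hf.prodMk hg)

theorem continuous_inl : Continuous (SemidirectProduct.inl : N → N ⋊[φ] H) :=
  continuous_mk continuous_id continuous_const

omit [TopologicalSpace N] [TopologicalSpace H] in
theorem smul_def (a : N ⋊[φ] H) (x : N) : a • x = a.left * φ a.right x := rfl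

omit [TopologicalSpace N] [TopologicalSpace H] in
theorem left_mul_eq_smul (a b : N ⋊[φ] H) : (a * b).left = a • b.left := rfl

omit [TopologicalSpace N] [TopologicalSpace H] in
theorem inl_mul_inr_eq (x : N) (h : H) : (inl x * inr h : N ⋊[φ] H) = ⟨x, h⟩ := by
  ext <;> simp

end SemidirectProduct

/-! ### The holonomy group and the extension by it -/

section LieAutTopology

variable {E : Type*} [NormedAddCommGroup E] [NormedSpace ℝ E]
  {G : Type*} [TopologicalSpace G] [ChartedSpace E G] [Group G]

instance LieAut.instT2Space [T2Space G] : T2Space (LieAut E G) := by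
  refine T2Space.of_injective_continuous (f := fun φ : LieAut E G =>
    (⟨fun x => (φ : MulAut G) x, φ.2.1.continuous⟩ : C(G, G))) ?_ continuous_induced_dom
  intro φ ψ h
  ext x
  exact DFunLike.congr_fun h x

theorem AffWith.toAff_injective (H : Subgroup (LieAut E G)) :
    Function.Injective (AffWith.toAff H) := by
  intro a b h
  have h1 := congrArg SemidirectProduct.left h
  have h2 := congrArg SemidirectProduct.right h
  exact SemidirectProduct.ext h1 (Subtype.ext h2)

theorem AffWith.contMDiff_aut {H : Subgroup (LieAut E G)} (h : H) :
    ContMDiff 𝓘(ℝ, E) 𝓘(ℝ, E) ∞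
      (((LieAut E G).subtype.comp H.subtype) h : G → G) := h.1.2.1

theorem AffWith.contMDiff_smul [LieGroup 𝓘(ℝ, E) ∞ G] {H : Subgroup (LieAut E G)} (a : AffWith H) :
    ContMDiff 𝓘(ℝ, E) 𝓘(ℝ, E) ∞ (fun x : G => a • x) :=
  contMDiff_const.mul (AffWith.contMDiff_aut a.right)

variable {K : Subgroup (LieAut E G)} (Γ : Subgroup (AffWith K))

theorem holonomy_le : holonomy Γ ≤ K := by
  rintro _ ⟨γ, -, rfl⟩
  exact γ.right.2

variable {Γ}

theorem mem_inHolonomyExtension {a : AffWith (holonomy Γ)} :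
    a ∈ inHolonomyExtension Γ ↔
      (⟨a.left, ⟨a.right, holonomy_le Γ a.right.2⟩⟩ : AffWith K) ∈ Γ := by
  constructor
  · rintro ⟨γ, hγ, h⟩
    have : γ = ⟨a.left, ⟨a.right, holonomy_le Γ a.right.2⟩⟩ := AffWith.toAff_injective K h
    rwa [← this]
  · exact fun h => ⟨_, h, rfl⟩

/-- An element of `Γ`, as an element of `G ⋊ hol(Γ)`. -/
def toHolonomyExtension (γ : Γ) : AffWith (holonomy Γ) :=
  ⟨γ.1.left, ⟨γ.1.right, γ.1, γ.2, rfl⟩⟩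

theorem toHolonomyExtension_mem (γ : Γ) : toHolonomyExtension γ ∈ inHolonomyExtension Γ :=
  mem_inHolonomyExtension.2 γ.2

theorem map_inHolonomyExtension :
    (inHolonomyExtension Γ).map (AffWith.toAff (holonomy Γ)) = Γ.map (AffWith.toAff K) := by
  rw [inHolonomyExtension, Subgroup.map_comap_eq, inf_eq_right]
  rintro _ ⟨γ, hγ, rfl⟩
  exact ⟨toHolonomyExtension ⟨γ, hγ⟩, rfl⟩

theorem isDiscrete_inHolonomyExtension (hΓ : Γ.IsDiscrete) :
    (inHolonomyExtension Γ).IsDiscrete := by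
  have : DiscreteTopology Γ := hΓ
  refine DiscreteTopology.of_continuous_injective
    (f := fun a : inHolonomyExtension Γ => (⟨_, mem_inHolonomyExtension.1 a.2⟩ : Γ)) ?_ ?_
  · refine Continuous.subtype_mk (SemidirectProduct.continuous_mk
      (SemidirectProduct.continuous_left.comp continuous_subtype_val)
      (Continuous.subtype_mk ?_ _)) _
    exact continuous_subtype_val.comp
      (SemidirectProduct.continuous_right.comp continuous_subtype_val)
  · intro a b h
    have h1 := congrArg (fun γ : Γ => γ.1.left) h
    have h2 := congrArg (fun γ : Γ => (γ.1.right : LieAut E G)) h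
    exact Subtype.ext (SemidirectProduct.ext h1 (Subtype.ext h2))

/-- Translations lie in the kernel of the holonomy projection, so that kernel has finite index and
the image is finite. -/
theorem finite_holonomy (hindex : ((AffWith.translations K).subgroupOf Γ).FiniteIndex) :
    Finite (holonomy Γ) := by
  let f : Γ →* LieAut E G := (K.subtype.comp SemidirectProduct.rightHom).comp Γ.subtype
  have hle : (AffWith.translations K).subgroupOf Γ ≤ f.ker := by
    rintro γ ⟨x, hx⟩
    rw [MonoidHom.mem_ker]
    change ((γ : AffWith K).right : LieAut E G) = 1
    rw [← show SemidirectProduct.inl x = (γ : AffWith K) from hx]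
    simp
  have hker : f.ker.FiniteIndex := Subgroup.finiteIndex_of_le hle
  have hrange : f.range = holonomy Γ := by
    rw [MonoidHom.range_comp, Subgroup.range_subtype]; rfl
  rw [← hrange]
  refine Nat.finite_of_card_ne_zero ?_
  rw [← Subgroup.index_ker]
  exact hker.index_ne_zero

end LieAutTopology

/-! ### Extensions of `G` by a finite group of automorphisms -/

section FiniteExtension

variable {E : Type*} [NormedAddCommGroup E] [NormedSpace ℝ E]
  {G : Type*} [TopologicalSpace G] [ChartedSpace E G] [Group G]
  {H : Subgroup (LieAut E G)}

theorem AffWith.isVirtuallyConnected [PreconnectedSpace G] [Finite H] :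
    IsVirtuallyConnected (AffWith H) := by
  refine Finite.of_surjective
    (fun h : H => ((SemidirectProduct.inr h : AffWith H) : ConnectedComponents (AffWith H))) ?_
  intro c
  obtain ⟨a, rfl⟩ := ConnectedComponents.surjective_coe c
  refine ⟨a.right, ?_⟩
  rw [ConnectedComponents.coe_eq_coe']
  have hc : Continuous (fun x : G => (⟨x, a.right⟩ : AffWith H)) :=
    SemidirectProduct.continuous_mk continuous_id continuous_const
  exact (isPreconnected_range hc).subset_connectedComponent (x := a) ⟨a.left, rfl⟩ ⟨1, rfl⟩

theorem AffWith.isVirtuallySolvable [Group.IsSolvable G] [Finite H] :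
    IsVirtuallySolvable (AffWith H) := by
  refine ⟨(SemidirectProduct.inl : G →* AffWith H).range, ?_,
    Group.isSolvable_of_surjective
      (SemidirectProduct.inl : G →* AffWith H).rangeRestrict_surjective⟩
  rw [SemidirectProduct.range_inl_eq_ker_rightHom]
  refine ⟨?_⟩
  rw [Subgroup.index_ker]
  exact Nat.card_pos.ne'

/-- A compact `C` containing the linear part meets `G` in a compact subgroup, which is trivial.
Dividing `a ∈ C` by its linear part stays in `C` and lands in `G`, so the translation part of `a` is
`1`. -/
theorem AffWith.isMaximalCompact_linearPart [FiniteDimensional ℝ E] [T2Space G]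
    [LieGroup 𝓘(ℝ, E) ∞ G] [SimplyConnectedSpace G] [Group.IsSolvable G] [Finite H] :
    (AffWith.linearPart H).IsMaximalCompact := by
  have hfin : (AffWith.linearPart H : Set (AffWith H)).Finite := by
    have : Finite (AffWith.linearPart H) :=
      Finite.of_surjective _ (SemidirectProduct.inr : H →* AffWith H).rangeRestrict_surjective
    exact Set.toFinite _
  refine ⟨hfin.isCompact, fun C hC hle a ha => ?_⟩
  let D : Subgroup G := C.comap (SemidirectProduct.inl : G →* AffWith H)
  have hemb : Topology.IsInducing (SemidirectProduct.inl : G → AffWith H) := by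
    refine Topology.IsInducing.of_comp SemidirectProduct.continuous_inl
      SemidirectProduct.continuous_left ?_
    exact Topology.IsInducing.id
  have hD : IsCompact (D : Set G) := by
    rw [hemb.isCompact_iff]
    have : SemidirectProduct.inl '' (D : Set G) =
        (C : Set (AffWith H)) ∩ SemidirectProduct.right ⁻¹' {1} := by
      ext b
      constructor
      · rintro ⟨x, hx, rfl⟩; exact ⟨hx, SemidirectProduct.right_inl x⟩
      · rintro ⟨hb, hb1⟩
        have hb' : SemidirectProduct.inl b.left = b :=
          SemidirectProduct.ext (SemidirectProduct.left_inl _) hb1.symm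
        exact ⟨b.left, by rw [SetLike.mem_coe, Subgroup.mem_comap, hb']; exact hb, hb'⟩
    rw [this]
    exact IsCompact.inter_right hC
      (isClosed_singleton.preimage SemidirectProduct.continuous_right)
  have hbot : D = ⊥ := LieGroup.eq_bot_of_isCompact E hD
  have hmem : a.left ∈ D := by
    change SemidirectProduct.inl a.left ∈ C
    have : SemidirectProduct.inl a.left = a * (SemidirectProduct.inr a.right)⁻¹ := by
      rw [eq_mul_inv_iff_mul_eq]; exact SemidirectProduct.inl_mul_inr_eq _ _
    rw [this]
    exact C.mul_mem ha (C.inv_mem (hle ⟨a.right, rfl⟩))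
  rw [hbot, Subgroup.mem_bot] at hmem
  exact ⟨a.right, SemidirectProduct.ext hmem.symm rfl⟩

/-- An element of finite order acts on `G` by an affine map of finite order, which has a fixed
point; freeness makes it trivial. -/
theorem AffWith.isTorsionFree_of_free [FiniteDimensional ℝ E]
    [LieGroup 𝓘(ℝ, E) ∞ G] [SimplyConnectedSpace G] [Group.IsSolvable G] {Λ : Subgroup (AffWith H)}
    (hfree : ∀ γ ∈ Λ, ∀ x : G, γ • x = x → γ = 1) : Λ.IsTorsionFreeGroup := by
  intro γ hγ hfin
  obtain ⟨m, hm, hpow⟩ := isOfFinOrder_iff_pow_eq_one.1 hfin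
  have hiter : ∀ (k : ℕ) (x : G), (fun x => γ • x)^[k] x = γ ^ k • x := by
    intro k x
    exact smul_iterate_apply γ k x
  obtain ⟨x, hx⟩ := Aff.exists_fixed_point (E := E) (α := (γ.right : LieAut E G))
    (γ.right : LieAut E G).2 (g := γ.left) hm (fun x => by
      have := hiter m x
      rw [hpow, one_smul] at this
      exact this)
  exact hfree γ hγ x hx

end FiniteExtension

/-! ### The action of a discrete group of affine maps -/

section ProperlyDiscontinuous

variable {E : Type*} [NormedAddCommGroup E] [NormedSpace ℝ E]
  {G : Type*} [TopologicalSpace G] [ChartedSpace E G] [Group G] [LieGroup 𝓘(ℝ, E) ∞ G]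
  {K : Subgroup (LieAut E G)} {Γ : Subgroup (AffWith K)}

theorem AffWith.continuousConstSMul (Γ : Subgroup (AffWith K)) : ContinuousConstSMul Γ G :=
  ⟨fun γ => (AffWith.contMDiff_smul (E := E) γ.1).continuous⟩

-- Split `Γ` into finitely many cosets `c (G ∩ Γ)`. If `γ = c t` moves a point of `A` into `B`, the
-- translation `t` lies in `(c⁻¹ B) A⁻¹`, a compact set, which meets the closed discrete group `G ∩
-- Γ` in a finite set.
open scoped Pointwise in
theorem AffWith.properlyDiscontinuousSMul [T2Space G] (hΓ : Γ.IsDiscrete)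
    (hindex : ((AffWith.translations K).subgroupOf Γ).FiniteIndex) :
    ProperlyDiscontinuousSMul Γ G := by
  have : IsTopologicalGroup G := topologicalGroup_of_lieGroup 𝓘(ℝ, E) ∞
  have : ContinuousConstSMul Γ G := AffWith.continuousConstSMul Γ
  have hdisc : DiscreteTopology Γ := hΓ
  let Γ₀ : Subgroup G := Γ.comap (SemidirectProduct.inl : G →* AffWith K)
  have hΓ₀ : DiscreteTopology Γ₀ := by
    refine DiscreteTopology.of_continuous_injective
      (f := fun x : Γ₀ => (⟨SemidirectProduct.inl x.1, x.2⟩ : Γ)) ?_ ?_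
    · exact (SemidirectProduct.continuous_inl.comp continuous_subtype_val).subtype_mk _
    · intro x y h
      exact Subtype.ext (SemidirectProduct.inl_injective (congrArg Subtype.val h))
  have hclosed : IsClosed (Γ₀ : Set G) := Subgroup.isClosed_of_discrete
  refine ⟨fun {A B} hA hB => ?_⟩
  have key (c : Γ) : {γ : Γ | c⁻¹ * γ ∈ (AffWith.translations K).subgroupOf Γ ∧
      ((γ • ·) '' A ∩ B).Nonempty}.Finite := by
    have hcpt : IsCompact (((fun x : G => c⁻¹ • x) '' B) / A ∩ (Γ₀ : Set G)) :=
      by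
      rw [div_eq_mul_inv]
      exact ((hB.image (continuous_const_smul c⁻¹)).mul hA.inv).inter_right hclosed
    have hfin : (((fun x : G => c⁻¹ • x) '' B) / A ∩ (Γ₀ : Set G)).Finite :=
      hcpt.finite ⟨DiscreteTopology.of_subset hΓ₀ inter_subset_right⟩
    have hinl {γ : Γ} (hγ : c⁻¹ * γ ∈ (AffWith.translations K).subgroupOf Γ) :
        SemidirectProduct.inl (c⁻¹ * γ : Γ).1.left = (c⁻¹ * γ : Γ).1 := by
      obtain ⟨x, hx⟩ := hγ
      change _ = (c⁻¹ * γ : Γ).1 at hx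
      rw [← hx, SemidirectProduct.left_inl]
    refine Set.Finite.of_injOn (f := fun γ : Γ => (c⁻¹ * γ : Γ).1.left) ?_ ?_ hfin
    · rintro γ ⟨hγ, b, ⟨a, ha, rfl⟩, hb⟩
      refine ⟨⟨_, ⟨γ • a, hb, rfl⟩, a, ha, ?_⟩, ?_⟩
      · change c⁻¹ • γ • a / a = _
        rw [← mul_smul, div_eq_iff_eq_mul, Subgroup.smul_def, ← hinl hγ]
        simp [SemidirectProduct.smul_def]
      · change SemidirectProduct.inl _ ∈ Γ
        rw [hinl hγ]
        exact (c⁻¹ * γ : Γ).2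
    · rintro γ ⟨hγ, -⟩ γ' ⟨hγ', -⟩ h
      have : c⁻¹ * γ = c⁻¹ * γ' := Subtype.ext (by
        rw [← hinl hγ, ← hinl hγ']; exact congrArg _ h)
      exact mul_left_cancel this
  have : Finite (Γ ⧸ (AffWith.translations K).subgroupOf Γ) := Subgroup.finite_quotient_of_finiteIndex
  refine (Set.finite_iUnion fun q : Γ ⧸ (AffWith.translations K).subgroupOf Γ =>
    key q.out).subset fun γ hγ => ?_
  refine mem_iUnion.2 ⟨(γ : Γ ⧸ (AffWith.translations K).subgroupOf Γ), ?_, hγ⟩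
  rw [← QuotientGroup.eq, QuotientGroup.out_eq']

end ProperlyDiscontinuous

/-! ### Compactness of quotients -/

section Cocompact

/-- A compact quotient of a locally compact space under an open map is the image of a compact
set. -/
theorem IsOpenMap.exists_isCompact_image_eq_univ {X Y : Type*} [TopologicalSpace X]
    [TopologicalSpace Y] [WeaklyLocallyCompactSpace X] [CompactSpace Y] {π : X → Y}
    (hπ : IsOpenMap π) (hsurj : Function.Surjective π) :
    ∃ D : Set X, IsCompact D ∧ π '' D = univ := by
  choose s hs using hsurj
  choose N hN hmem using fun x : X => exists_compact_mem_nhds x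
  obtain ⟨t, -, ht⟩ := (isCompact_univ (X := Y)).elim_nhds_subcover (fun y => π '' N (s y))
    (fun y _ => by simpa only [hs] using hπ.image_mem_nhds (hmem (s y)))
  refine ⟨⋃ y ∈ t, N (s y), t.isCompact_biUnion fun y _ => hN _, ?_⟩
  rw [image_iUnion₂]
  exact univ_subset_iff.1 ht

variable {E : Type*} [NormedAddCommGroup E] [NormedSpace ℝ E]
  {G : Type*} [TopologicalSpace G] [ChartedSpace E G] [Group G]
  {K : Subgroup (LieAut E G)} {Γ : Subgroup (AffWith K)}

/-- The projection `G ⋊ K → G` is `Γ`-equivariant, so `Γ \ (G ⋊ K)` maps continuously onto `Γ \ G`.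
-/
theorem compactSpace_orbitSpace (hΓ : Γ.IsCocompact) : CompactSpace (OrbitSpace Γ G) := by
  have : CompactSpace (Quotient (QuotientGroup.rightRel Γ)) := hΓ
  let f : Quotient (QuotientGroup.rightRel Γ) → OrbitSpace Γ G :=
    Quotient.map' SemidirectProduct.left (by
      intro a b h
      rw [QuotientGroup.rightRel_apply] at h
      refine (MulAction.orbitRel Γ G).symm ⟨⟨_, h⟩, ?_⟩
      change (b * a⁻¹) • a.left = b.left
      rw [← SemidirectProduct.left_mul_eq_smul, inv_mul_cancel_right])
  have hf : Continuous f := SemidirectProduct.continuous_left.quotient_map' _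
  have hsurj : Function.Surjective f := by
    intro q
    induction q using Quotient.inductionOn with
    | h x => exact ⟨Quotient.mk _ (SemidirectProduct.inl x), rfl⟩
  exact hsurj.compactSpace hf

/-- A compact `D ⊆ G` meeting every orbit of `Γ` yields the compact set `D × hol(Γ)`, which meets
every coset: move the left component into `D` by an element of `Γ`. -/
theorem isCocompact_inHolonomyExtension [FiniteDimensional ℝ E] [LieGroup 𝓘(ℝ, E) ∞ G]
    [Finite (holonomy Γ)] (hΓ : Γ.IsCocompact) : (inHolonomyExtension Γ).IsCocompact := by
  have : CompactSpace (OrbitSpace Γ G) := compactSpace_orbitSpace hΓ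
  have : ContinuousConstSMul Γ G := AffWith.continuousConstSMul Γ
  have : LocallyCompactSpace G := ChartedSpace.locallyCompactSpace E G
  obtain ⟨D, hD, hDuniv⟩ := IsOpenMap.exists_isCompact_image_eq_univ
    (π := (Quotient.mk (MulAction.orbitRel Γ G)))
    (isOpenMap_quotient_mk'_mul (Γ := Γ) (T := G)) Quotient.mk_surjective
  have hcpt : IsCompact (D ×ˢ (univ : Set (holonomy Γ))) := hD.prod finite_univ.isCompact
  let f : G × holonomy Γ → Quotient (QuotientGroup.rightRel (inHolonomyExtension Γ)) := fun p =>
    Quotient.mk _ (SemidirectProduct.homeomorphProd.symm p : AffWith (holonomy Γ))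
  have hf : Continuous f := continuous_quot_mk.comp SemidirectProduct.homeomorphProd.symm.continuous
  refine ⟨?_⟩
  convert hcpt.image hf
  refine (eq_univ_of_forall fun q => ?_).symm
  induction q using Quotient.inductionOn with
  | h a =>
    obtain ⟨x, hx, hxa⟩ : Quotient.mk (MulAction.orbitRel Γ G) a.left ∈ Quotient.mk _ '' D := by
      rw [hDuniv]; trivial
    obtain ⟨γ, hγ⟩ : (MulAction.orbitRel Γ G) x a.left := Quotient.exact hxa
    refine ⟨(x, (toHolonomyExtension γ * a).right), ⟨hx, trivial⟩, Quotient.sound ?_⟩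
    change QuotientGroup.rightRel (inHolonomyExtension Γ) _ a
    rw [QuotientGroup.rightRel_apply]
    have : (SemidirectProduct.homeomorphProd.symm (x, (toHolonomyExtension γ * a).right) :
        AffWith (holonomy Γ)) = toHolonomyExtension γ * a :=
      SemidirectProduct.ext hγ.symm rfl
    rw [this, mul_inv_rev, mul_inv_cancel_left]
    exact inv_mem (toHolonomyExtension_mem γ)

theorem free_inHolonomyExtension (hfree : ∀ γ ∈ Γ, ∀ x : G, γ • x = x → γ = 1) :
    ∀ γ ∈ inHolonomyExtension Γ, ∀ x : G, γ • x = x → γ = 1 := by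
  intro γ hγ x hx
  have h := hfree _ (mem_inHolonomyExtension.1 hγ) x hx
  have h1 := congrArg SemidirectProduct.left h
  have h2 := congrArg (fun a : AffWith K => (a.right : LieAut E G)) h
  exact SemidirectProduct.ext h1 (Subtype.ext h2)

end Cocompact

/-! ### The Lie group structure on an extension by a discrete group -/

section LieGroupStructure

variable {E : Type*} [NormedAddCommGroup E] [NormedSpace ℝ E]
  {G : Type*} [TopologicalSpace G] [ChartedSpace E G] [Group G]
  {H : Subgroup (LieAut E G)} [DiscreteTopology H]

/-- The component `G × {h}` of `G ⋊ H`, identified with `G`. -/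
def AffWith.component (h : H) : OpenPartialHomeomorph (AffWith H) G where
  toFun := SemidirectProduct.left
  invFun x := ⟨x, h⟩
  source := SemidirectProduct.right ⁻¹' {h}
  target := univ
  map_source' _ _ := trivial
  map_target' _ _ := rfl
  left_inv' _ ha := SemidirectProduct.ext rfl (Eq.symm ha)
  right_inv' _ _ := rfl
  open_source := (isOpen_discrete _).preimage SemidirectProduct.continuous_right
  open_target := isOpen_univ
  continuousOn_toFun := SemidirectProduct.continuous_left.continuousOn
  continuousOn_invFun :=
    (SemidirectProduct.continuous_mk continuous_id continuous_const).continuousOn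

theorem AffWith.exists_mem_component (a : AffWith H) :
    ∃ e ∈ range (AffWith.component (H := H)), a ∈ e.source :=
  ⟨_, ⟨a.right, rfl⟩, rfl⟩

theorem AffWith.hasSmoothTransitions_component :
    HasSmoothTransitions E (range (AffWith.component (H := H))) := by
  rintro _ ⟨h, rfl⟩ _ ⟨h', rfl⟩ x _ _
  exact contMDiffAt_id

/-- The smooth structure on `G ⋊ H` for which the components are copies of `G`. -/
@[reducible]
noncomputable def AffWith.chartedSpace (H : Subgroup (LieAut E G)) [DiscreteTopology H] :
    ChartedSpace E (AffWith H) :=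
  chartedSpaceOfCover (range AffWith.component) AffWith.exists_mem_component

section

attribute [local instance] AffWith.chartedSpace

variable [LieGroup 𝓘(ℝ, E) ∞ G]

theorem AffWith.isLocalDiffeomorph_left :
    IsLocalDiffeomorph 𝓘(ℝ, E) 𝓘(ℝ, E) ∞ (SemidirectProduct.left : AffWith H → G) := fun a =>
  AffWith.hasSmoothTransitions_component.isLocalDiffeomorphAt AffWith.exists_mem_component
    (e := AffWith.component a.right) ⟨_, rfl⟩ rfl

theorem AffWith.isLocalDiffeomorph_inl :
    IsLocalDiffeomorph 𝓘(ℝ, E) 𝓘(ℝ, E) ∞ (SemidirectProduct.inl : G → AffWith H) := fun _ =>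
  AffWith.hasSmoothTransitions_component.isLocalDiffeomorphAt_symm AffWith.exists_mem_component
    (e := AffWith.component 1) ⟨_, rfl⟩ trivial

/-- As `H` is discrete, continuity of the right component keeps `f` locally in one copy of `G`. -/
theorem AffWith.contMDiffAt_of_left {F M B : Type*} [NormedAddCommGroup F] [NormedSpace ℝ F]
    [TopologicalSpace B] {I : ModelWithCorners ℝ F B} [TopologicalSpace M] [ChartedSpace B M]
    {f : M → AffWith H} {z : M} (hl : ContMDiffAt I 𝓘(ℝ, E) ∞ (fun p => (f p).left) z)
    (hr : ContinuousAt (fun p => (f p).right) z) : ContMDiffAt I 𝓘(ℝ, E) ∞ f z := by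
  have h1 := AffWith.hasSmoothTransitions_component.contMDiffAt_symm
    AffWith.exists_mem_component (e := AffWith.component (f z).right) ⟨_, rfl⟩
    (x := (f z).left) trivial
  refine (h1.comp z hl).congr_of_eventuallyEq ?_
  filter_upwards [hr.eventually ((isOpen_discrete {(f z).right}).mem_nhds rfl)] with p hp
  exact SemidirectProduct.ext rfl hp

/-- Near a given point the linear parts are constant, so the operations combine those of `G` with
one fixed smooth automorphism. -/
theorem AffWith.lieGroup : LieGroup 𝓘(ℝ, E) ∞ (AffWith H) := by
  have hleft : ContMDiff 𝓘(ℝ, E) 𝓘(ℝ, E) ∞ (SemidirectProduct.left : AffWith H → G) :=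
    AffWith.isLocalDiffeomorph_left.contMDiff
  have hright : Continuous (SemidirectProduct.right : AffWith H → H) :=
    SemidirectProduct.continuous_right
  have hman : IsManifold 𝓘(ℝ, E) ∞ (AffWith H) :=
    AffWith.hasSmoothTransitions_component.isManifold AffWith.exists_mem_component
  refine { hman with contMDiff_mul := fun z => ?_, contMDiff_inv := fun z => ?_ }
  · refine AffWith.contMDiffAt_of_left ?_ ?_
    · have h1 : ContMDiff (𝓘(ℝ, E).prod 𝓘(ℝ, E)) 𝓘(ℝ, E) ∞
          (fun p : AffWith H × AffWith H => p.1.left *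
            (((LieAut E G).subtype.comp H.subtype) z.1.right : G → G) p.2.left) :=
        (hleft.comp contMDiff_fst).mul
          ((AffWith.contMDiff_aut z.1.right).comp (hleft.comp contMDiff_snd))
      refine (h1 z).congr_of_eventuallyEq ?_
      filter_upwards [(hright.comp continuous_fst).continuousAt.eventually
        ((isOpen_discrete {z.1.right}).mem_nhds rfl)] with p hp
      have hp' : p.1.right = z.1.right := hp
      rw [SemidirectProduct.mul_left, hp']
    · exact ((continuous_of_discreteTopology (f := fun q : H × H => q.1 * q.2)).comp
        ((hright.comp continuous_fst).prodMk (hright.comp continuous_snd))).continuousAt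
  · refine AffWith.contMDiffAt_of_left ?_ ?_
    · have h1 : ContMDiff 𝓘(ℝ, E) 𝓘(ℝ, E) ∞ (fun a : AffWith H =>
          (((LieAut E G).subtype.comp H.subtype) z.right⁻¹ : G → G) a.left⁻¹) :=
        (AffWith.contMDiff_aut z.right⁻¹).comp hleft.inv
      refine (h1 z).congr_of_eventuallyEq ?_
      filter_upwards [hright.continuousAt.eventually
        ((isOpen_discrete {z.right}).mem_nhds rfl)] with a ha
      have ha' : a.right = z.right := ha
      rw [SemidirectProduct.inv_left, ha']
    · exact ((continuous_of_discreteTopology (f := fun h : H => h⁻¹)).comp hright).continuousAt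

end

end LieGroupStructure

/-! ### Orbit space and double coset space -/

section Quotients

variable {E : Type*} [NormedAddCommGroup E] [NormedSpace ℝ E]
  {G : Type*} [TopologicalSpace G] [ChartedSpace E G] [Group G]
  {K : Subgroup (LieAut E G)}

/-- The canonical homeomorphism `Γ \ G ≃ₜ Γ \ (G ⋊ hol(Γ)) / hol(Γ)`. -/
def orbitSpaceHomeomorph (Γ : Subgroup (AffWith K)) : OrbitSpace Γ G ≃ₜ
    DoubleCosetSpace (inHolonomyExtension Γ) (AffWith.linearPart (holonomy Γ)) where
  toFun := Quotient.map' (SemidirectProduct.inl : G → AffWith (holonomy Γ)) (by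
    rintro _ y ⟨γ, rfl⟩
    refine DoubleCoset.rel_iff.2 ⟨(toHolonomyExtension γ)⁻¹, inv_mem (toHolonomyExtension_mem γ),
      SemidirectProduct.inr (toHolonomyExtension γ).right, ⟨_, rfl⟩, ?_⟩
    rw [mul_assoc, eq_inv_mul_iff_mul_eq, SemidirectProduct.inl_mul_inr_eq]
    refine SemidirectProduct.ext rfl ?_
    rw [SemidirectProduct.mul_right, SemidirectProduct.right_inl, mul_one])
  invFun := Quotient.map' (SemidirectProduct.left : AffWith (holonomy Γ) → G) (by
    intro a _ h
    obtain ⟨γ, hγ, _, ⟨h, rfl⟩, rfl⟩ := DoubleCoset.rel_iff.1 h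
    refine (MulAction.orbitRel Γ G).symm ⟨⟨_, mem_inHolonomyExtension.1 hγ⟩, ?_⟩
    rw [SemidirectProduct.mul_left (γ * a), SemidirectProduct.left_inr, map_one, mul_one]
    rfl)
  left_inv q := by
    induction q using Quotient.inductionOn with
    | h x => rfl
  right_inv q := by
    induction q using Quotient.inductionOn with
    | h a =>
      refine Quotient.sound (DoubleCoset.rel_iff.2 ⟨1, one_mem _, SemidirectProduct.inr a.right,
        ⟨_, rfl⟩, ?_⟩)
      rw [one_mul, SemidirectProduct.inl_mul_inr_eq]
  continuous_toFun := SemidirectProduct.continuous_inl.quotient_map' _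
  continuous_invFun := SemidirectProduct.continuous_left.quotient_map' _

theorem hasSmoothTransitions_localInverses_orbitSpace [LieGroup 𝓘(ℝ, E) ∞ G]
    (Γ : Subgroup (AffWith K)) :
    HasSmoothTransitions E (localInverses (Quotient.mk (MulAction.orbitRel Γ G))) := by
  refine hasSmoothTransitions_localInverses fun x x' h => ?_
  obtain ⟨γ, rfl⟩ : (MulAction.orbitRel Γ G) x' x := Quotient.exact h.symm
  exact ⟨fun z => γ.1 • z, AffWith.contMDiff_smul γ.1, rfl, fun z => Quotient.sound ⟨γ, rfl⟩⟩

end Quotients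

/-! ### The main theorem -/

theorem mainTheorem2
    {E : Type*} [NormedAddCommGroup E] [NormedSpace ℝ E] [FiniteDimensional ℝ E]
    {G : Type*} [TopologicalSpace G] [T2Space G] [SecondCountableTopology G]
    [ChartedSpace E G] [Group G] [LieGroup 𝓘(ℝ, E) ∞ G]
    [ConnectedSpace G] [SimplyConnectedSpace G] [Group.IsSolvable G]
    (K : Subgroup (LieAut E G)) (hK : K.IsMaximalCompact)
    (Γ : Subgroup (AffWith K)) (hdiscrete : Γ.IsDiscrete) (hcocompact : Γ.IsCocompact)
    (hfree : ∀ γ ∈ Γ, ∀ x : G, γ • x = x → γ = 1)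
    (hindex : ((AffWith.translations K).subgroupOf Γ).FiniteIndex) :
    -- `G ⋊ hol(Γ)` is virtually connected and virtually solvable
    IsVirtuallyConnected (AffWith (holonomy Γ)) ∧
    IsVirtuallySolvable (AffWith (holonomy Γ)) ∧
    -- `hol(Γ)` is finite, and it is a maximal compact subgroup of `G ⋊ hol(Γ)`
    Finite (holonomy Γ) ∧
    (AffWith.linearPart (holonomy Γ)).IsMaximalCompact ∧
    -- `Γ` is contained in `G ⋊ hol(Γ)`, where it is torsion-free, cocompact and discrete
    (inHolonomyExtension Γ).map (AffWith.toAff (holonomy Γ)) = Γ.map (AffWith.toAff K) ∧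
    (inHolonomyExtension Γ).IsTorsionFreeGroup ∧
    (inHolonomyExtension Γ).IsCocompact ∧
    (inHolonomyExtension Γ).IsDiscrete ∧
    -- `G ⋊ hol(Γ)` is a Lie group (with `G` as an open Lie subgroup), and `Γ \ G` is diffeomorphic
    -- to `Γ \ (G ⋊ hol(Γ)) / hol(Γ)`, by the map induced by the inclusion of `G`
    T2Space (AffWith (holonomy Γ)) ∧
    SecondCountableTopology (AffWith (holonomy Γ)) ∧
    ∃ (_ : ChartedSpace E (AffWith (holonomy Γ)))
      (_ : ChartedSpace E (OrbitSpace Γ G))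
      (_ : ChartedSpace E
        (DoubleCosetSpace (inHolonomyExtension Γ) (AffWith.linearPart (holonomy Γ)))),
      LieGroup 𝓘(ℝ, E) ∞ (AffWith (holonomy Γ)) ∧
      IsLocalDiffeomorph 𝓘(ℝ, E) 𝓘(ℝ, E) ∞
        (SemidirectProduct.inl : G → AffWith (holonomy Γ)) ∧
      IsQuotientManifold E (fun x : G => (⟦x⟧ : OrbitSpace Γ G)) ∧
      IsQuotientManifold E (fun x : AffWith (holonomy Γ) =>
        (⟦x⟧ : DoubleCosetSpace (inHolonomyExtension Γ) (AffWith.linearPart (holonomy Γ)))) ∧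
      ∃ Φ : Diffeomorph 𝓘(ℝ, E) 𝓘(ℝ, E) (OrbitSpace Γ G)
          (DoubleCosetSpace (inHolonomyExtension Γ) (AffWith.linearPart (holonomy Γ))) ∞,
        ∀ x : G, Φ ⟦x⟧ = ⟦(SemidirectProduct.inl x : AffWith (holonomy Γ))⟧ := by
  have hfin : Finite (holonomy Γ) := finite_holonomy hindex
  have hdiscH : DiscreteTopology (holonomy Γ) := inferInstance
  have hsc : SecondCountableTopology (AffWith (holonomy Γ)) :=
    SemidirectProduct.homeomorphProd.secondCountableTopology
  have hsmul : ContinuousConstSMul Γ G := AffWith.continuousConstSMul Γ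
  have hpd : ProperlyDiscontinuousSMul Γ G := AffWith.properlyDiscontinuousSMul hdiscrete hindex
  have hcancel : IsCancelSMul Γ G := isCancelSMul_iff_eq_one_of_smul_eq.2 fun γ x h =>
    Subtype.ext (hfree γ.1 γ.2 x h)
  have hlc : LocallyCompactSpace G := ChartedSpace.locallyCompactSpace E G
  have hT2 : T2Space (OrbitSpace Γ G) := t2Space_of_properlyDiscontinuousSMul_of_t2Space
  have hSC : SecondCountableTopology (OrbitSpace Γ G) :=
    ContinuousConstSMul.secondCountableTopology
  have hπ : IsLocalHomeomorph (Quotient.mk (MulAction.orbitRel Γ G)) :=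
    isQuotientCoveringMap_quotientMk_of_properlyDiscontinuousSMul.isCoveringMap.isLocalHomeomorph
  have hcover := exists_mem_localInverses hπ Quotient.mk_surjective
  have htrans := hasSmoothTransitions_localInverses_orbitSpace Γ
  let cO : ChartedSpace E (OrbitSpace Γ G) := chartedSpaceOfCover _ hcover
  have hmanO : IsManifold 𝓘(ℝ, E) ∞ (OrbitSpace Γ G) := htrans.isManifold hcover
  have hlocO : IsLocalDiffeomorph 𝓘(ℝ, E) 𝓘(ℝ, E) ∞ (fun x : G => (⟦x⟧ : OrbitSpace Γ G)) := by
    intro x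
    obtain ⟨e, hx, he⟩ := hπ x
    have he' : ⇑e = fun x : G => (⟦x⟧ : OrbitSpace Γ G) := he.symm
    rw [← he']
    exact htrans.isLocalDiffeomorphAt_symm hcover (e := e.symm) he.symm hx
  let cL : ChartedSpace E (AffWith (holonomy Γ)) := AffWith.chartedSpace (holonomy Γ)
  let Ψ := orbitSpaceHomeomorph Γ
  -- The smooth structure of the double coset space is transported along `Ψ`, which is thereby a
  -- diffeomorphism.
  have hcoverD : ∀ y, ∃ e ∈ ({Ψ.symm.toOpenPartialHomeomorph} : Set _), y ∈ e.source :=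
    fun _ => ⟨_, rfl, trivial⟩
  have htransD := hasSmoothTransitions_singleton (E := E) Ψ.symm
  let cD : ChartedSpace E
      (DoubleCosetSpace (inHolonomyExtension Γ) (AffWith.linearPart (holonomy Γ))) :=
    chartedSpaceOfCover _ hcoverD
  have hlocΨ : IsLocalDiffeomorph 𝓘(ℝ, E) 𝓘(ℝ, E) ∞ Ψ := fun q =>
    htransD.isLocalDiffeomorphAt_symm hcoverD rfl (x := q) trivial
  have hlocΨ' : IsLocalDiffeomorph 𝓘(ℝ, E) 𝓘(ℝ, E) ∞ Ψ.symm := fun q =>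
    htransD.isLocalDiffeomorphAt hcoverD rfl (y := q) trivial
  -- The projection factors as left component, orbit map, then `Ψ`, each a local diffeomorphism.
  have hcompD : (fun x : AffWith (holonomy Γ) =>
      (⟦x⟧ : DoubleCosetSpace (inHolonomyExtension Γ) (AffWith.linearPart (holonomy Γ)))) =
      fun x => Ψ ⟦x.left⟧ :=
    funext fun x => (Ψ.apply_symm_apply ⟦x⟧).symm
  refine ⟨AffWith.isVirtuallyConnected, AffWith.isVirtuallySolvable, hfin,
    AffWith.isMaximalCompact_linearPart, map_inHolonomyExtension,
    AffWith.isTorsionFree_of_free (free_inHolonomyExtension hfree),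
    isCocompact_inHolonomyExtension hcocompact, isDiscrete_inHolonomyExtension hdiscrete,
    SemidirectProduct.homeomorphProd.symm.t2Space, hsc, cL, cO, cD,
    AffWith.lieGroup, AffWith.isLocalDiffeomorph_inl,
    ⟨hT2, hSC, hmanO, Quotient.mk_surjective, hlocO⟩,
    ⟨Ψ.t2Space, Ψ.symm.secondCountableTopology, htransD.isManifold hcoverD,
      Quotient.mk_surjective, ?_⟩,
    { Ψ.toEquiv with
      contMDiff_toFun := hlocΨ.contMDiff
      contMDiff_invFun := hlocΨ'.contMDiff }, fun x => rfl⟩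
  rw [hcompD]
  intro a
  exact ((AffWith.isLocalDiffeomorph_left a).comp 𝓘(ℝ, E) _ (hlocO a.left)).comp 𝓘(ℝ, E) _ (hlocΨ _)
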